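/- **Theorem 2.1.** Let $k>0$, $\epsilon>0$, $T>2\epsilon$; let $B_r$ be the open ball of radius $r$ centred at the origin of $\mathbb R^3$, and put $D=B_\epsilon$, $\Omega=B_{T+\epsilon}$. Let $F\in L^2(\mathbb R^3)$ be complex valued with $\operatorname{supp}F\subset\overline{B_\epsilon}$, and let $u$ be a solution of the Cauchy problem $$(\partial_t^2-\Delta)u=0\ \text{ in }\mathbb R^3\times(0,T),\qquad u(\cdot,0)=0,\qquad \partial_tu(\cdot,0)=F,$$ that is, $u\in C^1([0,T];L^2(\mathbb R^3))$, the initial conditions hold in $L^2(\mathbb R^3)$, and for every $\varphi\in C_c^\infty(\mathbb R^3)$ and $0<t<T$ one has $\frac{d}{dt}\int\partial_tu(x,t)\varphi(x)\,dx=\int u(x,t)\Delta\varphi(x)\,dx$. Put $$G=-e^{-ikT}\bigl(\partial_tu(\cdot,T)+ik\,u(\cdot,T)\bigr)\in L^2(\mathbb R^3).$$ Then $\operatorname{supp}G\subset\overline{B_{T+\epsilon}}\setminus B_{T-\epsilon}$, and in particular $\operatorname{supp}G\cap\overline D=\emptyset$. Moreover, let $w$ and $\tilde w$ be outgoing fields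 with sources $F$ and $G$, that is, continuous functions on $\mathbb R^3$ with $$(\Delta+k^2)w+F=0,\qquad(\Delta+k^2)\tilde w+G=0$$ in the sense of distributions on $\mathbb R^3$, which both satisfy the outgoing radiation condition $\lim_{r\to\infty}r\left(\frac{\partial}{\partial r}-ik\right)v(r\omega)=0$ uniformly in $\omega\in S^2$ (for $v=w$ and $v=\tilde w$). Then $w(x)+\tilde w(x)=0$ for all $x\in\mathbb R^3\setminus\Omega$. Here the support of an $L^2$ function is the complement of the largest open set on which it vanishes almost everywhere. -/

import Mathlib

open MeasureTheory Metric

namespace Shielding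

/-- Three-dimensional Euclidean space. -/
abbrev R3 : Type := EuclideanSpace ℝ (Fin 3)

/-- The space `L²(ℝ³)` of complex-valued square integrable functions (modulo null sets). -/
abbrev L2 : Type := Lp ℂ 2 (volume : Measure R3)

/-- The support of a function defined up to null sets: the complement of the largest open set on
which the function vanishes almost everywhere. -/
def essSupport (f : R3 → ℂ) : Set R3 :=
  {x | ∀ U : Set R3, IsOpen U → x ∈ U → ¬ ∀ᵐ y ∂(volume : Measure R3), y ∈ U → f y = 0}

/-- Test functions, i.e. elements of `C_c^∞(ℝ³)`. -/
def IsTest (φ : R3 → ℂ) : Prop :=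
  ContDiff ℝ (⊤ : ℕ∞) φ ∧ HasCompactSupport φ

/-- The time derivative, in `L²(ℝ³)`, of a function of `t ∈ [0, T]` (one-sided at `0` and `T`). -/
noncomputable def timeDeriv (T : ℝ) (u : ℝ → L2) (t : ℝ) : L2 :=
  derivWithin u (Set.Icc 0 T) t

/-- `u` solves the Cauchy problem `(∂ₜ² - Δ) u = 0` in `ℝ³ × (0, T)`, `u(·, 0) = 0`,
`∂ₜu(·, 0) = F`: it belongs to `C¹([0, T]; L²(ℝ³))`, it attains the initial data, and the wave
equation holds in the sense of distributions on `ℝ³`, for every `t ∈ (0, T)`.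
Finite energy solutions, in `C([0, T]; H¹) ∩ C¹([0, T]; L²)`, are of this kind. -/
structure IsWaveSolution (T : ℝ) (F : L2) (u : ℝ → L2) : Prop where
  contDiffOn : ContDiffOn ℝ 1 u (Set.Icc 0 T)
  initial_value : u 0 = 0
  initial_velocity : timeDeriv T u 0 = F
  wave_equation : ∀ φ : R3 → ℂ, IsTest φ → ∀ t ∈ Set.Ioo 0 T,
    HasDerivAt (fun s : ℝ => ∫ x, timeDeriv T u s x * φ x)
      (∫ x, u t x * Laplacian.laplacian φ x) t

/-- The outgoing (Sommerfeld) radiation condition with wave number `k`: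
`r (∂/∂r - i k) w(r ω) → 0` as `r → ∞`, uniformly in the direction `ω`. The existence of
the derivative at all sufficiently distant points is part of the condition. -/
def IsOutgoing (k : ℝ) (w : R3 → ℂ) : Prop :=
  ∀ δ > 0, ∃ R > 0, ∀ x : R3, R ≤ ‖x‖ →
    DifferentiableAt ℝ w x ∧
      ‖(‖x‖ : ℂ) * (fderiv ℝ w x (‖x‖⁻¹ • x) - Complex.I * (k : ℂ) * w x)‖ < δ

/-- `w` is an outgoing field generated by the source `F`: a continuous function that satisfies
`(Δ + k²) w + F = 0` in the sense of distributions on `ℝ³`, and the outgoing radiation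
condition. -/
structure IsOutgoingField (k : ℝ) (F : L2) (w : R3 → ℂ) : Prop where
  continuous : Continuous w
  helmholtz : ∀ φ : R3 → ℂ, IsTest φ →
    (∫ x, w x * (Laplacian.laplacian φ x + (k : ℂ) ^ 2 * φ x)) + ∫ x, F x * φ x = 0
  outgoing : IsOutgoing k w

/-- The active source `G = -e^{-ikT} (∂ₜu(·, T) + i k u(·, T))`. -/
noncomputable def activeSource (k T : ℝ) (u : ℝ → L2) : L2 :=
  -(Complex.exp (-(Complex.I * (k : ℂ) * (T : ℂ))) •
    (timeDeriv T u T + (Complex.I * (k : ℂ)) • u T))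

end Shielding

/-!
# Active shielding: an outgoing source that cancels a given one

Everything rests on one distributional identity for radial kernels in `ℝ³`,
`Δ (g(|y|) / |y|) = g''(|y|) / |y| - 4π g(0) δ₀` (`integral_kern_laplacian`), where the profile `g`
is smooth and *not* assumed even. It is obtained by replacing `|y|` with `√(|y|² + δ²)` and letting
`δ → 0`. Convolving with a test function `φ` shows that the Laplacian acts on
`K_g φ = (g(|y|) / |y|) ⋆ φ` by differentiating the profile twice, up to the term `-4π g(0) φ`
(`laplacian_kernConv`). In this form spherical means, and their regularity, never appear.

*Support of the active source.* Let `u` be the wave and put `g_t(r) = g(r + t)`. The wave operator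
in `(t, r)` annihilates `g_t`, so the flux `∫ (∂ₜu K_{g_t} φ - u K_{g_t'} φ)` has derivative
`-4π g(t) ∫ u(t) φ`. Integration over `[0, T]` yields Kirchhoff's formula tested against `g`,
`4π ∫ g(t) (∫ u(t) φ) dt = ∫ F K_g φ` for `g` supported in `t < T` (`IsWaveSolution.kirchhoff`).
The right-hand side vanishes unless `g` meets the set of distances from `supp F` to `supp φ`. This
is finite propagation speed and the strong Huygens principle at once
(`IsWaveSolution.integral_eq_zero`), valid for the weak solutions considered here; in particular it
contains their uniqueness.

*Cancellation.* The field `V = ∫₀ᵀ e^{-ikt} u(t) dt` satisfies `(Δ + k²) V = -F - G`, since the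
boundary terms of the integration by parts in time are exactly `F` and the active source `G`
(`timeIntegral_helmholtz`), and it vanishes outside the ball of radius `T + ε`. Hence `w + w' - V`
solves the Helmholtz equation on all of `ℝ³` and is outgoing; such a function is zero
(`IsWeakHelmholtz.eq_zero_of_isOutgoing`).

*Uniqueness of entire outgoing solutions.* For `g(r) = χ(r - R) cos (k r)` with a cutoff `χ`, the
identity above expresses an entire solution `h` as the convolution of `h` with a smooth kernel of
size `O(1/R)` carried by the shell `R ≤ |y| ≤ R + 1`. This gives smoothness (Weyl's lemma,
`IsWeakHelmholtz.exists_contDiff`). Testing the equation with `θ(|x|²) h̄` shows that the radial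
flux of `Im (h̄ ∇h)` vanishes, so that `k² |h|² ≤ |∂ᵣh - ikh|² + 2k Im (h̄ ∂ᵣh)` and the radiation
condition force the `L²` mass of `h` in annuli of fixed width to tend to zero; the shell formula
then gives `h = 0`.
-/

namespace Shielding

open Filter Topology ComplexConjugate
open scoped ContDiff

/-- The vectors of the standard orthonormal basis of `ℝ³`. -/
noncomputable abbrev basisVec (i : Fin 3) : R3 := EuclideanSpace.basisFun (Fin 3) ℝ i

lemma norm_sq_eq_sum (y : R3) : ‖y‖ ^ 2 = ∑ i, y i ^ 2 := by
  simp [EuclideanSpace.norm_sq_eq]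

lemma inner_basisVec (y : R3) (i : Fin 3) : inner ℝ y (basisVec i) = y i := by
  simp [basisVec, EuclideanSpace.inner_single_right]

/-! ### Derivatives, the Laplacian and test functions -/

section Calculus

variable {F : Type*} [NormedAddCommGroup F] [NormedSpace ℝ F]

lemma contDiff_dir {f : R3 → F} (hf : ContDiff ℝ ∞ f) (v : R3) :
    ContDiff ℝ ∞ (fun x => fderiv ℝ f x v) :=
  (hf.fderiv_right (by simp)).clm_apply contDiff_const

/-- For a smooth function the Laplacian is the sum of the pure second partial derivatives. -/
lemma laplacian_eq_sum {f : R3 → F} (hf : ContDiff ℝ ∞ f) (x : R3) :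
    Laplacian.laplacian f x =
      ∑ i, fderiv ℝ (fun y => fderiv ℝ f y (basisVec i)) x (basisVec i) := by
  rw [InnerProductSpace.laplacian_eq_iteratedFDeriv_orthonormalBasis f
    (EuclideanSpace.basisFun (Fin 3) ℝ)]
  refine Finset.sum_congr rfl fun i _ => ?_
  rw [iteratedFDeriv_two_apply]
  have h : DifferentiableAt ℝ (fderiv ℝ f) x :=
    ((hf.fderiv_right (m := ∞) (by simp)).differentiable (by simp)) x
  rw [fderiv_clm_apply h (by fun_prop)]
  simp

lemma contDiff_laplacian {f : R3 → F} (hf : ContDiff ℝ ∞ f) :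
    ContDiff ℝ ∞ (Laplacian.laplacian f) := by
  rw [show Laplacian.laplacian f = fun x => ∑ i, fderiv ℝ
    (fun y => fderiv ℝ f y (basisVec i)) x (basisVec i) from funext (laplacian_eq_sum hf)]
  exact ContDiff.sum fun i _ => contDiff_dir (contDiff_dir hf _) _

end Calculus

namespace IsTest

variable {φ ψ : R3 → ℂ}

lemma continuous (h : IsTest φ) : Continuous φ := h.1.continuous

lemma integrable (h : IsTest φ) : Integrable φ := h.continuous.integrable_of_hasCompactSupport h.2

lemma dir (h : IsTest φ) (v : R3) : IsTest (fun x => fderiv ℝ φ x v) :=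
  ⟨contDiff_dir h.1 v, h.2.fderiv_apply ℝ v⟩

lemma laplacian (h : IsTest φ) : IsTest (Laplacian.laplacian φ) := by
  refine ⟨contDiff_laplacian h.1, ?_⟩
  rw [show Laplacian.laplacian φ = fun x => ∑ i, fderiv ℝ
    (fun y => fderiv ℝ φ y (basisVec i)) x (basisVec i) from funext (laplacian_eq_sum h.1)]
  simp only [Fin.sum_univ_three]
  exact ((((h.dir _).dir _).2.add ((h.dir _).dir _).2).add ((h.dir _).dir _).2)

lemma reflect (h : IsTest φ) (x : R3) : IsTest (fun y => φ (x - y)) := by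
  refine ⟨h.1.comp (contDiff_const.sub contDiff_id), ?_⟩
  exact h.2.comp_homeomorph (Homeomorph.subLeft x)

lemma zero_outside_ball (h : IsTest φ) : ∃ ρ > 0, ∀ x, ρ ≤ ‖x‖ → φ x = 0 := by
  obtain ⟨ρ, hρ, hs⟩ := h.2.isCompact.isBounded.subset_ball_lt 0 (0 : R3)
  refine ⟨ρ, hρ, fun x hx => image_eq_zero_of_notMem_tsupport fun hm => ?_⟩
  have := hs hm
  rw [mem_ball_zero_iff] at this
  linarith

lemma bounded (h : IsTest φ) : ∃ C, ∀ x, ‖φ x‖ ≤ C := h.continuous.bounded_above_of_compact_support h.2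

end IsTest

lemma isTest_of_zero_outside {φ : R3 → ℂ} (hφ : ContDiff ℝ ∞ φ) {ρ : ℝ}
    (h : ∀ x, ρ ≤ ‖x‖ → φ x = 0) : IsTest φ := by
  refine ⟨hφ, HasCompactSupport.of_support_subset_isCompact (isCompact_closedBall 0 ρ) ?_⟩
  intro x hx
  by_contra hn
  rw [mem_closedBall_zero_iff, not_le] at hn
  exact hx (h x hn.le)

lemma fderiv_comp_sub_left {f : R3 → ℂ} (hf : ContDiff ℝ ∞ f) (x y v : R3) :
    fderiv ℝ (fun y => f (x - y)) y v = - fderiv ℝ f (x - y) v := by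
  have h1 : HasFDerivAt f (fderiv ℝ f (x - y)) (x - y) :=
    (hf.differentiable (by simp) _).hasFDerivAt
  have h2 : HasFDerivAt (fun y => x - y) (-ContinuousLinearMap.id ℝ R3) y :=
    (hasFDerivAt_id y).const_sub x
  have h3 : HasFDerivAt (fun y => f (x - y)) _ y := h1.comp y h2
  rw [h3.fderiv]
  simp

lemma laplacian_comp_sub_left {f : R3 → ℂ} (hf : ContDiff ℝ ∞ f) (x y : R3) :
    Laplacian.laplacian (fun y => f (x - y)) y = Laplacian.laplacian f (x - y) := by
  have h : ContDiff ℝ ∞ (fun y => f (x - y)) := hf.comp (contDiff_const.sub contDiff_id)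
  rw [laplacian_eq_sum h, laplacian_eq_sum hf]
  refine Finset.sum_congr rfl fun i _ => ?_
  simp_rw [fderiv_comp_sub_left hf x]
  rw [fderiv_fun_neg, neg_apply,
    fderiv_comp_sub_left (contDiff_dir hf _) x, neg_neg]

/-! ### Integration by parts -/

section IntegrationByParts

variable {𝕜 : Type*} [RCLike 𝕜] [NormedSpace 𝕜 ℂ]

lemma integral_smul_dir {f : R3 → 𝕜} (hf : ContDiff ℝ ∞ f) {φ : R3 → ℂ} (hφ : IsTest φ) (v : R3) :
    ∫ x, f x • fderiv ℝ φ x v = - ∫ x, fderiv ℝ f x v • φ x := by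
  have hfc := hf.continuous
  have hφc := hφ.continuous
  have hd := (contDiff_dir hf v).continuous
  have hd' := (hφ.dir v).continuous
  refine integral_smul_fderiv_eq_neg_fderiv_smul_of_integrable ?_ ?_ ?_ ?_ ?_
  · exact (hd.smul hφc).integrable_of_hasCompactSupport hφ.2.smul_left
  · exact (hfc.smul hd').integrable_of_hasCompactSupport (hφ.dir v).2.smul_left
  · exact (hfc.smul hφc).integrable_of_hasCompactSupport hφ.2.smul_left
  · exact fun x _ => hf.differentiable (by simp) x
  · exact fun x _ => hφ.1.differentiable (by simp) x

lemma integral_smul_laplacian_eq_sum {f : R3 → 𝕜} (hf : ContDiff ℝ ∞ f) {φ : R3 → ℂ}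
    (hφ : IsTest φ) :
    ∫ x, f x • Laplacian.laplacian φ x =
      - ∑ i, ∫ x, fderiv ℝ f x (basisVec i) • fderiv ℝ φ x (basisVec i) := by
  simp_rw [laplacian_eq_sum hφ.1, Finset.smul_sum]
  rw [integral_finsetSum _ fun i _ => ?_, ← Finset.sum_neg_distrib]
  · exact Finset.sum_congr rfl fun i _ => integral_smul_dir hf (hφ.dir _) _
  · exact (hf.continuous.smul ((hφ.dir _).dir _).continuous).integrable_of_hasCompactSupport
      ((hφ.dir _).dir _).2.smul_left

/-- Green's identity for a smooth function and a test function. -/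
lemma integral_smul_laplacian {f : R3 → 𝕜} (hf : ContDiff ℝ ∞ f) {φ : R3 → ℂ} (hφ : IsTest φ) :
    ∫ x, f x • Laplacian.laplacian φ x = ∫ x, Laplacian.laplacian f x • φ x := by
  rw [integral_smul_laplacian_eq_sum hf hφ]
  simp_rw [laplacian_eq_sum hf, Finset.sum_smul]
  rw [integral_finsetSum _ fun i _ => ?_, ← Finset.sum_neg_distrib]
  · refine Finset.sum_congr rfl fun i _ => ?_
    rw [integral_smul_dir (contDiff_dir hf _) hφ, neg_neg]
  · exact (((contDiff_dir (contDiff_dir hf _) _).continuous.smul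
      hφ.continuous).integrable_of_hasCompactSupport hφ.2.smul_left)

end IntegrationByParts

/-! ### Radial functions of a smoothed radius -/

section Regularisation

/-- A smooth regularisation of the norm. -/
noncomputable def softNorm (δ : ℝ) (y : R3) : ℝ := √(‖y‖ ^ 2 + δ ^ 2)

variable {δ : ℝ}

lemma softNorm_pos (hδ : 0 < δ) (y : R3) : 0 < softNorm δ y := Real.sqrt_pos.2 (by positivity)

lemma softNorm_sq (δ : ℝ) (y : R3) : softNorm δ y ^ 2 = ‖y‖ ^ 2 + δ ^ 2 :=
  Real.sq_sqrt (by positivity)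

lemma norm_le_softNorm (δ : ℝ) (y : R3) : ‖y‖ ≤ softNorm δ y :=
  Real.le_sqrt_of_sq_le (by nlinarith [sq_nonneg δ])

lemma le_softNorm (δ : ℝ) (y : R3) : δ ≤ softNorm δ y :=
  Real.le_sqrt_of_sq_le (by nlinarith [sq_nonneg ‖y‖])

lemma contDiff_softNorm (hδ : 0 < δ) : ContDiff ℝ ∞ (softNorm δ) :=
  ((contDiff_norm_sq ℝ).add contDiff_const).sqrt fun y => by positivity

lemma fderiv_softNorm (hδ : 0 < δ) (y : R3) (i : Fin 3) :
    fderiv ℝ (softNorm δ) y (basisVec i) = y i / softNorm δ y := by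
  have h1 : HasFDerivAt (fun y : R3 => ‖y‖ ^ 2 + δ ^ 2) (2 • (innerSL ℝ y)) y :=
    ((hasStrictFDerivAt_norm_sq y).hasFDerivAt).add_const _
  have h2 := h1.sqrt (by positivity)
  change HasFDerivAt (softNorm δ) _ y at h2
  rw [h2.fderiv]
  have := softNorm_pos hδ y
  simp only [smul_apply, innerSL_apply_apply, inner_basisVec, smul_eq_mul,
    nsmul_eq_mul]
  change 1 / (2 * softNorm δ y) * ((2 : ℕ) * y i) = _
  push_cast
  field_simp

lemma fderiv_comp_softNorm (hδ : 0 < δ) {Q : ℝ → ℝ} {Q' : ℝ} {y : R3} {i : Fin 3}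
    (hQ : HasDerivAt Q Q' (softNorm δ y)) :
    fderiv ℝ (fun y => Q (softNorm δ y)) y (basisVec i) = Q' * (y i / softNorm δ y) := by
  have h1 : HasFDerivAt (softNorm δ) (fderiv ℝ (softNorm δ) y) y :=
    ((contDiff_softNorm hδ).differentiable (by simp) _).hasFDerivAt
  have h2 : HasFDerivAt (fun y => Q (softNorm δ y)) _ y := hQ.comp_hasFDerivAt y h1
  rw [h2.fderiv, smul_apply, fderiv_softNorm hδ,
    smul_eq_mul]

lemma contDiff_comp_softNorm (hδ : 0 < δ) {Q : ℝ → ℝ} (hQ : ContDiffOn ℝ ∞ Q (Set.Ioi 0)) :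
    ContDiff ℝ ∞ (fun y => Q (softNorm δ y)) := by
  rw [contDiff_iff_contDiffAt]
  intro y
  exact (hQ.contDiffAt (Ioi_mem_nhds (softNorm_pos hδ y))).comp y (contDiff_softNorm hδ).contDiffAt

/-- The Laplacian of a radial function, expressed through the regularised radius. -/
lemma laplacian_comp_softNorm (hδ : 0 < δ) {Q S S' : ℝ → ℝ} (hQs : ContDiffOn ℝ ∞ Q (Set.Ioi 0))
    (hQ : ∀ r > 0, HasDerivAt Q (r * S r) r) (hS : ∀ r > 0, HasDerivAt S (r * S' r) r) (y : R3) :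
    Laplacian.laplacian (fun y => Q (softNorm δ y)) y =
      S' (softNorm δ y) * ‖y‖ ^ 2 + 3 * S (softNorm δ y) := by
  rw [laplacian_eq_sum (contDiff_comp_softNorm hδ hQs), norm_sq_eq_sum, Finset.mul_sum]
  have h3 : 3 * S (softNorm δ y) = ∑ i : Fin 3, S (softNorm δ y) := by simp
  rw [h3, ← Finset.sum_add_distrib]
  refine Finset.sum_congr rfl fun i _ => ?_
  have e1 : (fun y => fderiv ℝ (fun y => Q (softNorm δ y)) y (basisVec i)) =
      fun y => S (softNorm δ y) * y i := by
    funext z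
    have := softNorm_pos hδ z
    rw [fderiv_comp_softNorm hδ (hQ _ this)]
    field_simp
  have hp := softNorm_pos hδ y
  have hd : DifferentiableAt ℝ (fun y => S (softNorm δ y)) y :=
    (hS _ hp).differentiableAt.comp y ((contDiff_softNorm hδ).differentiable (by simp) y)
  have hc : HasFDerivAt (fun y : R3 => y i) (EuclideanSpace.proj i : R3 →L[ℝ] ℝ) y :=
    (EuclideanSpace.proj i : R3 →L[ℝ] ℝ).hasFDerivAt
  rw [e1, fderiv_fun_mul hd hc.differentiableAt, hc.fderiv]
  simp only [add_apply, smul_apply, smul_eq_mul,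
    fderiv_comp_softNorm hδ (hS _ hp)]
  simp [basisVec]
  field_simp
  ring

end Regularisation

/-! ### Radial kernels in `ℝ³` -/

section RadialKernel

/-- The radial kernel `g(|y|) / |y|` with profile `g`. At the origin the division gives `0`, a null
set that no integral sees. -/
noncomputable def kern (g : ℝ → ℝ) (y : R3) : ℝ := g ‖y‖ / ‖y‖

lemma integrable_radial {f h : ℝ → ℝ} (hh : Continuous h) {N : ℝ} (hN : ∀ r, N ≤ r → h r = 0)
    (hf : ∀ r > 0, r ^ 2 * f r = h r) : Integrable (fun y : R3 => f ‖y‖) := by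
  rw [integrable_fun_norm_addHaar]
  simp only [finrank_euclideanSpace, Fintype.card_fin, smul_eq_mul]
  have h1 : IntegrableOn h (Set.Ioi 0) := by
    have h2 : IntegrableOn h (Set.Icc 0 N) := hh.continuousOn.integrableOn_Icc
    refine h2.of_forall_sdiff_eq_zero measurableSet_Ioi fun r hr => hN r ?_
    by_contra hc
    exact hr.2 ⟨(Set.mem_Ioi.1 hr.1).le, (not_le.1 hc).le⟩
  exact h1.congr_fun (fun r hr => (hf r hr).symm) measurableSet_Ioi

lemma integrable_kern {g : ℝ → ℝ} (hg : Continuous g) {N : ℝ} (hN : ∀ r, N ≤ r → g r = 0) :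
    Integrable (kern g) := by
  refine integrable_radial (f := fun r => g r / r) (h := fun r => r * g r) (N := N) (by fun_prop)
    (fun r hr => by rw [hN r hr, mul_zero]) fun r hr => ?_
  field_simp

/-- A piecewise affine profile that is at least one on `[0, M]` and vanishes beyond `M + 1`. -/
noncomputable def tent (M r : ℝ) : ℝ := max 0 (M + 1 - r)

lemma continuous_tent (M : ℝ) : Continuous (tent M) := by unfold tent; fun_prop

lemma tent_eq_zero {M r : ℝ} (h : M + 1 ≤ r) : tent M r = 0 := max_eq_left (by linarith)

lemma one_le_tent {M r : ℝ} (h : r ≤ M) : 1 ≤ tent M r := le_max_of_le_right (by linarith)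

lemma tent_nonneg (M r : ℝ) : 0 ≤ tent M r := le_max_left _ _

lemma ae_ne_zero : ∀ᵐ y : R3, y ≠ 0 := by
  simp [ae_iff]

/-- Dominated convergence for kernels that are `O(|y|⁻¹ + |y|⁻²)` near the origin of `ℝ³`. -/
lemma tendsto_integral_kernel {a : ℝ → R3 → ℝ} {a₀ : R3 → ℝ} {ψ : R3 → ℂ} (hψ : IsTest ψ)
    (ha : ∀ δ > 0, Continuous (a δ))
    (hbound : ∀ M > 0, ∃ C, 0 ≤ C ∧ ∀ δ > 0, δ ≤ 1 → ∀ y : R3, y ≠ 0 → ‖y‖ ≤ M →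
      |a δ y| ≤ C * (‖y‖⁻¹ + (‖y‖ ^ 2)⁻¹))
    (hlim : ∀ y : R3, y ≠ 0 → Tendsto (fun δ => a δ y) (𝓝[>] 0) (𝓝 (a₀ y))) :
    Tendsto (fun δ => ∫ y, a δ y • ψ y) (𝓝[>] 0) (𝓝 (∫ y, a₀ y • ψ y)) := by
  obtain ⟨M, hM, hMψ⟩ := hψ.zero_outside_ball
  obtain ⟨B, hB⟩ := hψ.bounded
  have hB0 : 0 ≤ B := (norm_nonneg _).trans (hB 0)
  obtain ⟨C, hC0, hC⟩ := hbound M hM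
  have i1 : Integrable (fun y : R3 => tent M ‖y‖ * (‖y‖⁻¹ + (‖y‖ ^ 2)⁻¹)) := by
    refine integrable_radial (f := fun r => tent M r * (r⁻¹ + (r ^ 2)⁻¹))
      (h := fun r => tent M r * (r + 1)) (N := M + 1)
      ((continuous_tent M).mul (by fun_prop)) (fun r hr => by rw [tent_eq_zero hr, zero_mul])
      fun r hr => ?_
    field_simp
  have hmem : ∀ᶠ δ : ℝ in 𝓝[>] 0, 0 < δ ∧ δ ≤ 1 := by
    filter_upwards [Ioc_mem_nhdsGT (zero_lt_one (α := ℝ))] with δ hδ using hδ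
  refine tendsto_integral_filter_of_dominated_convergence
    (fun y => (B * C) * (tent M ‖y‖ * (‖y‖⁻¹ + (‖y‖ ^ 2)⁻¹))) ?_ ?_ (i1.const_mul _) ?_
  · filter_upwards [hmem] with δ hδ
    exact ((ha δ hδ.1).smul hψ.continuous).aestronglyMeasurable
  · filter_upwards [hmem] with δ hδ
    filter_upwards [ae_ne_zero] with y hy
    have hy' : 0 < ‖y‖ := norm_pos_iff.2 hy
    rcases le_or_gt M ‖y‖ with h | h
    · rw [hMψ y h, smul_zero, norm_zero]
      have := tent_nonneg M ‖y‖
      positivity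
    · rw [norm_smul, Real.norm_eq_abs]
      have h1 := hC δ hδ.1 hδ.2 y hy h.le
      have h2 := one_le_tent h.le
      have h3 : 0 ≤ ‖y‖⁻¹ + (‖y‖ ^ 2)⁻¹ := by positivity
      calc |a δ y| * ‖ψ y‖ ≤ (C * (‖y‖⁻¹ + (‖y‖ ^ 2)⁻¹)) * B :=
            mul_le_mul h1 (hB y) (norm_nonneg _) (by positivity)
        _ = (B * C) * (1 * (‖y‖⁻¹ + (‖y‖ ^ 2)⁻¹)) := by ring
        _ ≤ _ := by gcongr
  · filter_upwards [ae_ne_zero] with y hy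
    exact (hlim y hy).smul_const _

/-- The total mass of `3 (1 + |z|²)^(-5/2)`; its value is `4π`, but only positivity matters. -/
noncomputable def sphConst : ℝ := ∫ z : R3, 3 / softNorm 1 z ^ 5

lemma continuous_softNorm (δ : ℝ) : Continuous (softNorm δ) := by unfold softNorm; fun_prop

lemma integrable_softNorm_pow : Integrable (fun z : R3 => 3 / softNorm 1 z ^ 5) := by
  have h := (integrable_rpow_neg_one_add_norm_sq (E := R3) (μ := volume) (r := 5)
    (by simp; norm_num)).const_mul 3
  refine h.congr (Eventually.of_forall fun z => ?_)
  have h0 : (0 : ℝ) ≤ 1 + ‖z‖ ^ 2 := by positivity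
  have : softNorm 1 z ^ 5 = (1 + ‖z‖ ^ 2) ^ (5 / 2 : ℝ) := by
    unfold softNorm
    rw [Real.sqrt_eq_rpow, ← Real.rpow_natCast, ← Real.rpow_mul (by positivity), one_pow,
      add_comm]
    norm_num
  simp only [this]
  rw [neg_div, Real.rpow_neg h0, ← div_eq_mul_inv]

lemma sphConst_pos : 0 < sphConst := by
  have hp : ∀ z : R3, 0 < 3 / softNorm 1 z ^ 5 := fun z => by
    have := softNorm_pos one_pos z
    positivity
  refine (integral_pos_iff_support_of_nonneg (fun z => (hp z).le) integrable_softNorm_pow).2 ?_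
  rw [show Function.support (fun z : R3 => 3 / softNorm 1 z ^ 5) = Set.univ from
    Set.eq_univ_of_forall fun z => (hp z).ne']
  simp

lemma softNorm_smul {δ : ℝ} (hδ : 0 < δ) (z : R3) : softNorm δ (δ • z) = δ * softNorm 1 z := by
  unfold softNorm
  rw [norm_smul, Real.norm_of_nonneg hδ.le, show (δ * ‖z‖) ^ 2 + δ ^ 2 = δ ^ 2 * (‖z‖ ^ 2 + 1 ^ 2)
    by ring, Real.sqrt_mul (by positivity), Real.sqrt_sq hδ.le]

lemma softNorm_le {δ : ℝ} (hδ : 0 ≤ δ) (y : R3) : softNorm δ y ≤ ‖y‖ + δ := by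
  unfold softNorm
  rw [Real.sqrt_le_left (by positivity)]
  nlinarith [norm_nonneg y]

/-- The concentrating part of the regularised kernel is an approximate identity. -/
lemma tendsto_integral_concentrating {g : ℝ → ℝ} (hg : Continuous g) {ψ : R3 → ℂ}
    (hψ : IsTest ψ) :
    Tendsto (fun δ => ∫ y, (3 * δ ^ 2 * g (softNorm δ y) / softNorm δ y ^ 5) • ψ y) (𝓝[>] 0)
      (𝓝 ((sphConst * g 0) • ψ 0)) := by
  have hmem : ∀ᶠ δ : ℝ in 𝓝[>] 0, 0 < δ ∧ δ ≤ 1 := by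
    filter_upwards [Ioc_mem_nhdsGT (zero_lt_one (α := ℝ))] with δ hδ using hδ
  -- The substitution `y = δ z` turns `3 δ² / (|y|² + δ²)^(5/2)` into a fixed density.
  have hscale : ∀ᶠ δ : ℝ in 𝓝[>] 0,
      ∫ z, ((3 / softNorm 1 z ^ 5) * g (δ * softNorm 1 z)) • ψ (δ • z) =
      ∫ y, (3 * δ ^ 2 * g (softNorm δ y) / softNorm δ y ^ 5) • ψ y := by
    filter_upwards [hmem] with δ hδ
    have h := Measure.integral_comp_smul (volume : Measure R3)
      (fun y => (3 * δ ^ 2 * g (softNorm δ y) / softNorm δ y ^ 5) • ψ y) δ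
    have hδ0 := hδ.1
    simp only [finrank_euclideanSpace, Fintype.card_fin, softNorm_smul hδ.1] at h
    rw [abs_of_pos (by positivity)] at h
    have h' : ∫ y, (3 * δ ^ 2 * g (softNorm δ y) / softNorm δ y ^ 5) • ψ y = δ ^ 3 •
        ∫ z, (3 * δ ^ 2 * g (δ * softNorm 1 z) / (δ * softNorm 1 z) ^ 5) • ψ (δ • z) := by
      rw [h, smul_smul, mul_inv_cancel₀ (by positivity), one_smul]
    rw [h', ← integral_smul]
    refine integral_congr_ae (Eventually.of_forall fun z => ?_)
    have := softNorm_pos one_pos z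
    simp only [smul_smul]
    congr 1
    field_simp
  refine Tendsto.congr' hscale ?_
  have hlimit : (sphConst * g 0) • ψ 0 = ∫ z, ((3 / softNorm 1 z ^ 5) * g 0) • ψ 0 := by
    rw [integral_smul_const, integral_mul_const, sphConst]
  rw [hlimit]
  obtain ⟨M, hM, hMψ⟩ := hψ.zero_outside_ball
  obtain ⟨B, hB⟩ := hψ.bounded
  have hB0 : 0 ≤ B := (norm_nonneg _).trans (hB 0)
  obtain ⟨C, hC⟩ := (isCompact_Icc (a := (0 : ℝ)) (b := M + 1)).exists_bound_of_continuousOn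
    hg.continuousOn
  have hC0 : 0 ≤ C := (norm_nonneg _).trans (hC 0 ⟨le_rfl, by linarith⟩)
  refine tendsto_integral_filter_of_dominated_convergence
    (fun z => (B * C) * (3 / softNorm 1 z ^ 5)) ?_ ?_ (integrable_softNorm_pow.const_mul _) ?_
  · refine Eventually.of_forall fun δ => Continuous.aestronglyMeasurable ?_
    have h1 := continuous_softNorm 1
    have h2 := hψ.continuous
    have h3 : ∀ z, softNorm 1 z ^ 5 ≠ 0 := fun z => pow_ne_zero _ (softNorm_pos one_pos z).ne'
    exact ((continuous_const.div (h1.pow 5) h3).mul (hg.comp (continuous_const.mul h1))).smul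
      (h2.comp (continuous_const_smul δ))
  · filter_upwards [hmem] with δ hδ
    refine Eventually.of_forall fun z => ?_
    have hs := softNorm_pos one_pos z
    have h0 : 0 ≤ 3 / softNorm 1 z ^ 5 := by positivity
    rcases le_or_gt M ‖δ • z‖ with h | h
    · rw [hMψ _ h, smul_zero, norm_zero]
      positivity
    · have h1 : ‖g (δ * softNorm 1 z)‖ ≤ C := by
        refine hC _ ⟨mul_nonneg hδ.1.le hs.le, ?_⟩
        rw [← softNorm_smul hδ.1]
        linarith [softNorm_le hδ.1.le (δ • z), hδ.2]
      rw [norm_smul, norm_mul, Real.norm_of_nonneg h0]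
      calc 3 / softNorm 1 z ^ 5 * ‖g (δ * softNorm 1 z)‖ * ‖ψ (δ • z)‖
          ≤ 3 / softNorm 1 z ^ 5 * C * B := by
            gcongr
            exact hB _
        _ = _ := by ring
  · refine Eventually.of_forall fun z => ?_
    have c1 : Continuous fun δ : ℝ =>
        ((3 / softNorm 1 z ^ 5) * g (δ * softNorm 1 z)) • ψ (δ • z) := by
      have := hψ.continuous
      fun_prop
    have := c1.tendsto 0
    simp only [zero_mul, zero_smul] at this
    exact this.mono_left nhdsWithin_le_nhds

lemma tendsto_softNorm (y : R3) : Tendsto (fun δ => softNorm δ y) (𝓝[>] 0) (𝓝 ‖y‖) := by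
  have c1 : Continuous fun δ => softNorm δ y := by unfold softNorm; fun_prop
  have := c1.tendsto 0
  rw [show softNorm 0 y = ‖y‖ by simp [softNorm]] at this
  exact this.mono_left nhdsWithin_le_nhds

lemma tendsto_integral_regularised {g : ℝ → ℝ} (hg : Continuous g) {ψ : R3 → ℂ}
    (hψ : IsTest ψ) :
    Tendsto (fun δ => ∫ y, (g (softNorm δ y) / softNorm δ y) • ψ y) (𝓝[>] 0)
      (𝓝 (∫ y, kern g y • ψ y)) := by
  refine tendsto_integral_kernel hψ (fun δ hδ => ?_) (fun M hM => ?_) fun y hy => ?_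
  · exact (hg.comp (continuous_softNorm δ)).div (continuous_softNorm δ)
      fun y => (softNorm_pos hδ y).ne'
  · obtain ⟨C, hC⟩ := (isCompact_Icc (a := (0 : ℝ)) (b := M + 1)).exists_bound_of_continuousOn
      hg.continuousOn
    have hC0 : 0 ≤ C := (norm_nonneg _).trans (hC 0 ⟨le_rfl, by linarith⟩)
    refine ⟨C, hC0, fun δ hδ hδ1 y hy hyM => ?_⟩
    have hs := softNorm_pos hδ y
    have hy' : 0 < ‖y‖ := norm_pos_iff.2 hy
    rw [abs_div, abs_of_pos hs, div_eq_mul_inv]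
    have h1 := hC (softNorm δ y) ⟨hs.le, by linarith [softNorm_le hδ.le y]⟩
    rw [Real.norm_eq_abs] at h1
    have h2 : (softNorm δ y)⁻¹ ≤ ‖y‖⁻¹ := inv_anti₀ hy' (norm_le_softNorm δ y)
    have h3 : 0 ≤ (‖y‖ ^ 2)⁻¹ := by positivity
    exact mul_le_mul h1 (by linarith) (by positivity) hC0
  · have h1 := tendsto_softNorm y
    exact ((hg.tendsto _).comp h1).div h1 (norm_ne_zero_iff.2 hy)

/-- The part of the regularised kernel that disappears in the limit. -/
lemma tendsto_integral_vanishing {g₁ g₂ : ℝ → ℝ} (hg₁ : Continuous g₁) (hg₂ : Continuous g₂)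
    {ψ : R3 → ℂ} (hψ : IsTest ψ) :
    Tendsto (fun δ => ∫ y, (δ ^ 2 * (g₂ (softNorm δ y) / softNorm δ y ^ 3 -
      3 * g₁ (softNorm δ y) / softNorm δ y ^ 4)) • ψ y) (𝓝[>] 0) (𝓝 0) := by
  have key := tendsto_integral_kernel (a := fun δ y => δ ^ 2 * (g₂ (softNorm δ y) / softNorm δ y ^ 3
      - 3 * g₁ (softNorm δ y) / softNorm δ y ^ 4)) (a₀ := fun _ => 0) hψ
      (fun δ hδ => ?_) (fun M hM => ?_) fun y hy => ?_
  · simpa using key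
  · have h1 := continuous_softNorm δ
    have h0 : ∀ y, softNorm δ y ≠ 0 := fun y => (softNorm_pos hδ y).ne'
    exact continuous_const.mul (((hg₂.comp h1).div (h1.pow 3) fun y => pow_ne_zero _ (h0 y)).sub
      ((continuous_const.mul (hg₁.comp h1)).div (h1.pow 4) fun y => pow_ne_zero _ (h0 y)))
  · obtain ⟨C₁, hC₁⟩ := (isCompact_Icc (a := (0 : ℝ)) (b := M + 1)).exists_bound_of_continuousOn
      hg₁.continuousOn
    obtain ⟨C₂, hC₂⟩ := (isCompact_Icc (a := (0 : ℝ)) (b := M + 1)).exists_bound_of_continuousOn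
      hg₂.continuousOn
    have hC0 : 0 ≤ C₁ := (norm_nonneg _).trans (hC₁ 0 ⟨le_rfl, by linarith⟩)
    have hC0' : 0 ≤ C₂ := (norm_nonneg _).trans (hC₂ 0 ⟨le_rfl, by linarith⟩)
    refine ⟨3 * C₁ + C₂, by positivity, fun δ hδ hδ1 y hy hyM => ?_⟩
    have hs := softNorm_pos hδ y
    have hδs := le_softNorm δ y
    have hy' : 0 < ‖y‖ := norm_pos_iff.2 hy
    have hm : softNorm δ y ∈ Set.Icc 0 (M + 1) := ⟨hs.le, by linarith [softNorm_le hδ.le y]⟩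
    have h1 := hC₁ _ hm
    have h2 := hC₂ _ hm
    rw [Real.norm_eq_abs] at h1 h2
    have h3 : (softNorm δ y)⁻¹ ≤ ‖y‖⁻¹ := inv_anti₀ hy' (norm_le_softNorm δ y)
    have h4 : ((softNorm δ y) ^ 2)⁻¹ ≤ (‖y‖ ^ 2)⁻¹ :=
      inv_anti₀ (by positivity) (by gcongr; exact norm_le_softNorm δ y)
    set s := softNorm δ y
    -- The factor `δ² / s² ≤ 1` is given away for the bound; it is what makes the limit zero.
    have hq : δ ^ 2 / s ^ 2 ≤ 1 := by
      rw [div_le_one (by positivity)]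
      gcongr
    have e : δ ^ 2 * (g₂ s / s ^ 3 - 3 * g₁ s / s ^ 4) =
        (δ ^ 2 / s ^ 2) * (g₂ s * s⁻¹ - 3 * g₁ s * (s ^ 2)⁻¹) := by
      field_simp
    rw [e, abs_mul, abs_of_nonneg (by positivity : 0 ≤ δ ^ 2 / s ^ 2)]
    have h5 : |g₂ s * s⁻¹ - 3 * g₁ s * (s ^ 2)⁻¹| ≤ C₂ * ‖y‖⁻¹ + 3 * C₁ * (‖y‖ ^ 2)⁻¹ := by
      refine (abs_sub _ _).trans ?_
      rw [abs_mul, abs_mul, abs_mul, abs_of_pos (by positivity : 0 < s⁻¹),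
        abs_of_pos (by positivity : 0 < (s ^ 2)⁻¹), abs_of_pos (by norm_num : (0 : ℝ) < 3)]
      gcongr
    calc δ ^ 2 / s ^ 2 * |g₂ s * s⁻¹ - 3 * g₁ s * (s ^ 2)⁻¹|
        ≤ 1 * (C₂ * ‖y‖⁻¹ + 3 * C₁ * (‖y‖ ^ 2)⁻¹) :=
          mul_le_mul hq h5 (abs_nonneg _) zero_le_one
      _ ≤ _ := by
        have : 0 ≤ ‖y‖⁻¹ := by positivity
        have : 0 ≤ (‖y‖ ^ 2)⁻¹ := by positivity
        nlinarith [mul_nonneg hC0 this, mul_nonneg hC0' this,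
          mul_nonneg hC0 (inv_nonneg.2 hy'.le)]
  · have h1 := tendsto_softNorm y
    have hy' := norm_ne_zero_iff.2 hy
    have h2 : Tendsto (fun δ : ℝ => δ ^ 2) (𝓝[>] 0) (𝓝 (0 ^ 2)) :=
      ((continuous_pow 2).tendsto 0).mono_left nhdsWithin_le_nhds
    have h3 := h2.mul ((((hg₂.tendsto _).comp h1).div (h1.pow 3) (pow_ne_zero _ hy')).sub
      ((((hg₁.tendsto _).comp h1).const_mul 3).div (h1.pow 4) (pow_ne_zero _ hy')))
    simpa using h3

lemma integral_regularised_laplacian {g : ℝ → ℝ} (hg : ContDiff ℝ ∞ g) {ψ : R3 → ℂ}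
    (hψ : IsTest ψ) {δ : ℝ} (hδ : 0 < δ) :
    ∫ y, (g (softNorm δ y) / softNorm δ y) • Laplacian.laplacian ψ y =
      (∫ y, (deriv (deriv g) (softNorm δ y) / softNorm δ y) • ψ y) -
      (∫ y, (δ ^ 2 * (deriv (deriv g) (softNorm δ y) / softNorm δ y ^ 3 -
        3 * deriv g (softNorm δ y) / softNorm δ y ^ 4)) • ψ y) -
      ∫ y, (3 * δ ^ 2 * g (softNorm δ y) / softNorm δ y ^ 5) • ψ y := by
  have hg1 : ContDiff ℝ ∞ (deriv g) := (contDiff_infty_iff_deriv.1 hg).2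
  have hg2 : ContDiff ℝ ∞ (deriv (deriv g)) := (contDiff_infty_iff_deriv.1 hg1).2
  have d0 : ∀ r, HasDerivAt g (deriv g r) r := fun r =>
    (hg.differentiable (by simp) r).hasDerivAt
  have d1 : ∀ r, HasDerivAt (deriv g) (deriv (deriv g) r) r := fun r =>
    (hg1.differentiable (by simp) r).hasDerivAt
  have hs : ContDiffOn ℝ ∞ (fun r => g r / r) (Set.Ioi 0) :=
    hg.contDiffOn.div contDiffOn_id fun r hr => (Set.mem_Ioi.1 hr).ne'
  have hsmooth := contDiff_comp_softNorm hδ hs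
  have hsn : ∀ y, softNorm δ y ≠ 0 := fun y => (softNorm_pos hδ y).ne'
  rw [integral_smul_laplacian hsmooth hψ]
  have hint : ∀ {a : R3 → ℝ}, Continuous a → Integrable (fun y => a y • ψ y) := fun ha =>
    (ha.smul hψ.continuous).integrable_of_hasCompactSupport hψ.2.smul_left
  have c := continuous_softNorm δ
  have c0 := hg.continuous
  have c1 := hg1.continuous
  have c2 := hg2.continuous
  rw [← integral_sub, ← integral_sub]
  · refine integral_congr_ae (Eventually.of_forall fun y => ?_)
    dsimp only
    rw [laplacian_comp_softNorm hδ hs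
      (S := fun r => deriv g r / r ^ 2 - g r / r ^ 3)
      (S' := fun r => deriv (deriv g) r / r ^ 3 - 3 * deriv g r / r ^ 4 + 3 * g r / r ^ 5),
      ← sub_smul, ← sub_smul]
    · congr 1
      have e : ‖y‖ ^ 2 = softNorm δ y ^ 2 - δ ^ 2 := by rw [softNorm_sq]; ring
      rw [e]
      have := hsn y
      field_simp
      ring
    · intro r hr
      refine ((d0 r).div (hasDerivAt_id r) hr.ne').congr_deriv ?_
      have : r ≠ 0 := hr.ne'
      simp only [id]
      field_simp
    · intro r hr
      have : r ≠ 0 := hr.ne'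
      refine (((d1 r).div (hasDerivAt_pow 2 r) (by positivity)).sub
        ((d0 r).div (hasDerivAt_pow 3 r) (by positivity))).congr_deriv ?_
      push_cast
      field_simp
      ring
  · refine (hint ?_).sub (hint ?_)
    · exact (c2.comp c).div c hsn
    · exact continuous_const.mul (((c2.comp c).div (c.pow 3) fun y => pow_ne_zero _ (hsn y)).sub
        ((continuous_const.mul (c1.comp c)).div (c.pow 4) fun y => pow_ne_zero _ (hsn y)))
  · exact hint ((continuous_const.mul (c0.comp c)).div (c.pow 5) fun y => pow_ne_zero _ (hsn y))
  · exact hint ((c2.comp c).div c hsn)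
  · refine hint ?_
    exact continuous_const.mul (((c2.comp c).div (c.pow 3) fun y => pow_ne_zero _ (hsn y)).sub
        ((continuous_const.mul (c1.comp c)).div (c.pow 4) fun y => pow_ne_zero _ (hsn y)))

/-- In the sense of distributions, `Δ (g(|y|) / |y|) = g''(|y|) / |y| - 4π g(0) δ₀`. -/
theorem integral_kern_laplacian {g : ℝ → ℝ} (hg : ContDiff ℝ ∞ g) {ψ : R3 → ℂ}
    (hψ : IsTest ψ) :
    ∫ y, kern g y • Laplacian.laplacian ψ y =
      (∫ y, kern (deriv (deriv g)) y • ψ y) - (sphConst * g 0) • ψ 0 := by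
  have hg1 : ContDiff ℝ ∞ (deriv g) := (contDiff_infty_iff_deriv.1 hg).2
  have hg2 : ContDiff ℝ ∞ (deriv (deriv g)) := (contDiff_infty_iff_deriv.1 hg1).2
  have t1 := tendsto_integral_regularised hg.continuous hψ.laplacian
  have t2 := ((tendsto_integral_regularised hg2.continuous hψ).sub
    (tendsto_integral_vanishing hg1.continuous hg2.continuous hψ)).sub
    (tendsto_integral_concentrating hg.continuous hψ)
  rw [sub_zero] at t2
  refine tendsto_nhds_unique t1 (t2.congr' ?_)
  filter_upwards [self_mem_nhdsWithin] with δ hδ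
  exact (integral_regularised_laplacian hg hψ hδ).symm

end RadialKernel

/-! ### Convolution with radial kernels -/

section KernelConvolution

/-- The convolution of the radial kernel `kern g` with `φ`. -/
noncomputable def kernConv (g : ℝ → ℝ) (φ : R3 → ℂ) (x : R3) : ℂ := ∫ y, kern g y • φ (x - y)

lemma kernConv_eq_convolution (g : ℝ → ℝ) (φ : R3 → ℂ) :
    kernConv g φ = convolution (kern g) φ (ContinuousLinearMap.lsmul ℝ ℝ) volume := rfl

variable {g : ℝ → ℝ} {φ : R3 → ℂ} {N : ℝ}

lemma integrable_kernConv_integrand (hg : Continuous g) (hN : ∀ r, N ≤ r → g r = 0)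
    (hφ : IsTest φ) (x : R3) : Integrable (fun y => kern g y • φ (x - y)) := by
  obtain ⟨B, hB⟩ := hφ.bounded
  exact (integrable_kern hg hN).smul_bdd B (hφ.reflect x).continuous.aestronglyMeasurable
    (Eventually.of_forall fun y => hB _)

/-- The value of `kernConv g φ` at `x` involves only the values of the profile `g` at distances
from `x` to the support of `φ`. -/
lemma kernConv_eq_zero {x : R3} (h : ∀ y, φ (x - y) ≠ 0 → g ‖y‖ = 0) : kernConv g φ x = 0 := by
  unfold kernConv
  rw [← integral_zero R3 ℂ]
  congr 1
  funext y
  by_cases hy : φ (x - y) = 0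
  · rw [hy, smul_zero]
  · rw [kern, h y hy, zero_div, zero_smul]

lemma kernConv_isTest (hg : Continuous g) (hN : ∀ r, N ≤ r → g r = 0) (hφ : IsTest φ) :
    IsTest (kernConv g φ) := by
  obtain ⟨ρ, -, hρ⟩ := hφ.zero_outside_ball
  refine isTest_of_zero_outside (ρ := N + ρ) ?_ fun x hx => kernConv_eq_zero fun y hy => hN _ ?_
  · exact hφ.2.contDiff_convolution_right (n := ⊤) (ContinuousLinearMap.lsmul ℝ ℝ)
      (integrable_kern hg hN).locallyIntegrable hφ.1
  · by_contra hc
    refine hy (hρ _ ?_)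
    have := norm_sub_norm_le x y
    linarith

lemma fderiv_kernConv (hg : Continuous g) (hN : ∀ r, N ≤ r → g r = 0) (hφ : IsTest φ)
    (x v : R3) :
    fderiv ℝ (kernConv g φ) x v = kernConv g (fun z => fderiv ℝ φ z v) x := by
  have hl := (integrable_kern hg hN).locallyIntegrable
  have hφ1 : ContDiff ℝ 1 φ := hφ.1.of_le (by exact_mod_cast le_top)
  have h := hφ.2.hasFDerivAt_convolution_right (ContinuousLinearMap.lsmul ℝ ℝ) hl hφ1 x
  rw [kernConv_eq_convolution, h.fderiv, convolution_precompR_apply _ hl (hφ.2.fderiv ℝ)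
    (hφ1.continuous_fderiv (by simp)), kernConv_eq_convolution]

lemma laplacian_kernConv_eq (hg : Continuous g) (hN : ∀ r, N ≤ r → g r = 0) (hφ : IsTest φ)
    (x : R3) :
    Laplacian.laplacian (kernConv g φ) x = kernConv g (Laplacian.laplacian φ) x := by
  rw [laplacian_eq_sum (kernConv_isTest hg hN hφ).1]
  have e : ∀ i, (fun y => fderiv ℝ (kernConv g φ) y (basisVec i)) =
      kernConv g (fun z => fderiv ℝ φ z (basisVec i)) := fun i =>
    funext fun y => fderiv_kernConv hg hN hφ y _
  simp_rw [e, fderiv_kernConv hg hN (hφ.dir _)]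
  unfold kernConv
  simp_rw [laplacian_eq_sum hφ.1, Finset.smul_sum]
  rw [integral_finsetSum]
  exact fun i _ => integrable_kernConv_integrand hg hN ((hφ.dir _).dir _) x

lemma deriv_eq_zero_of_lt (hN : ∀ r, N ≤ r → g r = 0) {r : ℝ} (hr : N < r) : deriv g r = 0 := by
  have : g =ᶠ[𝓝 r] fun _ => 0 := by
    filter_upwards [Ioi_mem_nhds hr] with s hs using hN s (Set.mem_Ioi.1 hs).le
  rw [this.deriv_eq, deriv_const]

/-- The convolution of a test function with `g(|y|) / |y|`, seen as a superposition over the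
radius `r` of spherical means, satisfies a one-dimensional identity: the Laplacian differentiates
the profile twice, up to a point source at the origin. -/
theorem laplacian_kernConv (hg : ContDiff ℝ ∞ g) (hN : ∀ r, N ≤ r → g r = 0) (hφ : IsTest φ)
    (x : R3) :
    Laplacian.laplacian (kernConv g φ) x =
      kernConv (deriv (deriv g)) φ x - (sphConst * g 0) • φ x := by
  rw [laplacian_kernConv_eq hg.continuous hN hφ]
  have h := integral_kern_laplacian hg (hφ.reflect x)
  simp only [laplacian_comp_sub_left hφ.1, sub_zero] at h
  exact h

lemma kernConv_add {g₁ g₂ : ℝ → ℝ} (hg₁ : Continuous g₁) (hN₁ : ∀ r, N ≤ r → g₁ r = 0)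
    (hg₂ : Continuous g₂) (hN₂ : ∀ r, N ≤ r → g₂ r = 0) (hφ : IsTest φ) (x : R3) :
    kernConv (fun r => g₁ r + g₂ r) φ x = kernConv g₁ φ x + kernConv g₂ φ x := by
  unfold kernConv
  rw [← integral_add (integrable_kernConv_integrand hg₁ hN₁ hφ x)
    (integrable_kernConv_integrand hg₂ hN₂ hφ x)]
  congr 1
  funext y
  simp only [kern, add_div, add_smul]

lemma kernConv_const_mul (a : ℝ) (x : R3) :
    kernConv (fun r => a * g r) φ x = a • kernConv g φ x := by
  unfold kernConv
  rw [← integral_smul]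
  congr 1
  funext y
  simp only [kern, mul_div_assoc, smul_smul]

lemma norm_kernConv_le (hN : ∀ r, N ≤ r → g r = 0) {A B : ℝ} (hB0 : 0 ≤ B)
    (hA : ∀ r, 0 ≤ r → |g r| ≤ A) (hB : ∀ x, ‖φ x‖ ≤ B) (x : R3) :
    ‖kernConv g φ x‖ ≤ A * (B * ∫ y : R3, kern (tent N) y) := by
  have hA0 : 0 ≤ A := (abs_nonneg _).trans (hA 0 le_rfl)
  have hi : Integrable (kern (tent N)) :=
    integrable_kern (continuous_tent N) fun r hr => tent_eq_zero hr
  unfold kernConv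
  rw [← integral_const_mul, ← integral_const_mul]
  refine norm_integral_le_of_norm_le ((hi.const_mul _).const_mul _)
    (Eventually.of_forall fun y => ?_)
  rw [norm_smul, kern, kern, norm_div, norm_norm, Real.norm_eq_abs]
  rcases le_or_gt N ‖y‖ with h | h
  · rw [hN _ h, abs_zero, zero_div, zero_mul]
    have := tent_nonneg N ‖y‖
    positivity
  · have h1 := one_le_tent h.le
    calc |g ‖y‖| / ‖y‖ * ‖φ (x - y)‖ ≤ A / ‖y‖ * B := by
          gcongr
          · exact hA _ (norm_nonneg _)
          · exact hB _
      _ = A * (B * (1 / ‖y‖)) := by ring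
      _ ≤ _ := by gcongr

end KernelConvolution

/-! ### The bilinear pairing on `L²` -/

section Pairing

/-- The bilinear (not sesquilinear) pairing `∫ f g` on `L²(ℝ³)`. -/
noncomputable def pairing : L2 →L[ℝ] L2 →L[ℝ] ℂ :=
  (ContinuousLinearMap.mul ℝ ℂ).lpPairing volume 2 2

lemma pairing_apply (f g : L2) : pairing f g = ∫ x, f x * g x :=
  (ContinuousLinearMap.mul ℝ ℂ).lpPairing_eq_integral f g

lemma IsTest.memLp {φ : R3 → ℂ} (hφ : IsTest φ) : MemLp φ 2 (volume : Measure R3) :=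
  hφ.continuous.memLp_of_hasCompactSupport hφ.2

/-- The class in `L²(ℝ³)` of a test function. -/
noncomputable def IsTest.toL2 {φ : R3 → ℂ} (hφ : IsTest φ) : L2 := hφ.memLp.toLp φ

lemma pairing_toL2 (f : L2) {φ : R3 → ℂ} (hφ : IsTest φ) :
    pairing f hφ.toL2 = ∫ x, f x * φ x := by
  rw [pairing_apply]
  refine integral_congr_ae ?_
  filter_upwards [hφ.memLp.coeFn_toLp] with x hx
  rw [← hx, IsTest.toL2]

lemma integrable_mul_test (f : L2) {φ : R3 → ℂ} (hφ : IsTest φ) :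
    Integrable (fun x => f x * φ x) :=
  (Lp.memLp f).integrable_mul hφ.memLp

lemma norm_toL2_le {φ : R3 → ℂ} (hφ : IsTest φ) {A M : ℝ} (hA : ∀ x, ‖φ x‖ ≤ A)
    (hM : ∀ x, M ≤ ‖x‖ → φ x = 0) :
    ‖hφ.toL2‖ ≤ A * ((volume (ball (0 : R3) M)) ^ (1 / 2 : ℝ)).toReal := by
  have hA0 : 0 ≤ A := (norm_nonneg _).trans (hA 0)
  have hfin : volume (ball (0 : R3) M) ^ (1 / 2 : ℝ) ≠ ⊤ :=
    ENNReal.rpow_ne_top_of_nonneg (by norm_num) measure_ball_lt_top.ne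
  have h1 : eLpNorm φ 2 volume ≤ ENNReal.ofReal A * volume (ball (0 : R3) M) ^ (1 / 2 : ℝ) := by
    calc eLpNorm φ 2 volume ≤ eLpNorm ((ball (0 : R3) M).indicator fun _ => A) 2 volume := by
          refine eLpNorm_mono_real fun x => ?_
          by_cases hx : x ∈ ball (0 : R3) M
          · rw [Set.indicator_of_mem hx]
            exact hA x
          · rw [Set.indicator_of_notMem hx, hM x (by simpa using hx), norm_zero]
      _ ≤ ‖A‖ₑ * volume (ball (0 : R3) M) ^ (1 / (2 : ENNReal).toReal) :=
          eLpNorm_indicator_const_le _ _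
      _ = _ := by rw [Real.enorm_eq_ofReal hA0]; simp
  rw [IsTest.toL2, Lp.norm_toLp]
  refine (ENNReal.toReal_mono (ENNReal.mul_ne_top ENNReal.ofReal_ne_top hfin) h1).trans ?_
  rw [ENNReal.toReal_mul, ENNReal.toReal_ofReal hA0]

end Pairing

/-! ### Translation of profiles -/

section Profile

/-- Smooth compactly supported profiles of radial kernels. -/
structure IsProfile (g : ℝ → ℝ) : Prop where
  contDiff : ContDiff ℝ ∞ g
  compact : HasCompactSupport g

variable {g : ℝ → ℝ} {φ : R3 → ℂ}

namespace IsProfile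

lemma deriv (hg : IsProfile g) : IsProfile (deriv g) :=
  ⟨(contDiff_infty_iff_deriv.1 hg.1).2, hg.2.deriv⟩

lemma shift (hg : IsProfile g) (t : ℝ) : IsProfile (fun r => g (r + t)) :=
  ⟨hg.1.comp (contDiff_id.add contDiff_const), hg.2.comp_homeomorph (Homeomorph.addRight t)⟩

lemma exists_zero (hg : IsProfile g) : ∃ N > 0, ∀ r, N ≤ |r| → g r = 0 := by
  obtain ⟨N, hN, hs⟩ := hg.2.isCompact.isBounded.subset_ball_lt 0 (0 : ℝ)
  refine ⟨N, hN, fun x hx => image_eq_zero_of_notMem_tsupport fun hm => ?_⟩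
  have := hs hm
  rw [mem_ball_zero_iff, Real.norm_eq_abs] at this
  linarith

lemma hasDerivAt (hg : IsProfile g) (r : ℝ) : HasDerivAt g (_root_.deriv g r) r :=
  (hg.1.differentiable (by simp) r).hasDerivAt

lemma bounded (hg : IsProfile g) : ∃ C, ∀ r, |g r| ≤ C :=
  hg.1.continuous.bounded_above_of_compact_support hg.2

lemma isTest_kernConv (hg : IsProfile g) (hφ : IsTest φ) : IsTest (kernConv g φ) := by
  obtain ⟨N, -, hN⟩ := hg.exists_zero
  exact kernConv_isTest hg.1.continuous (fun r hr => hN r (hr.trans (le_abs_self r))) hφ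

/-- First order Taylor expansion with a uniform quadratic remainder. -/
lemma taylor (hg : IsProfile g) :
    ∃ C, 0 ≤ C ∧ ∀ a h, |g (a + h) - g a - h * _root_.deriv g a| ≤ C * h ^ 2 := by
  obtain ⟨C, hC⟩ := hg.deriv.deriv.bounded
  have hC0 : 0 ≤ C := (abs_nonneg _).trans (hC 0)
  refine ⟨C, hC0, fun a h => ?_⟩
  have h1 : ∀ s, |_root_.deriv g (a + s) - _root_.deriv g a| ≤ C * |s| := fun s => by
    have := Convex.norm_image_sub_le_of_norm_hasDerivWithin_le (s := Set.univ) (C := C)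
      (x := a) (y := a + s) (fun x _ => (hg.deriv.hasDerivAt x).hasDerivWithinAt)
      (fun x _ => hC x) convex_univ (Set.mem_univ _) (Set.mem_univ _)
    simpa using this
  have h2 : ∀ s, HasDerivAt (fun s => g (a + s) - s * _root_.deriv g a)
      (_root_.deriv g (a + s) - _root_.deriv g a) s := fun s => by
    have e1 : HasDerivAt (fun s => g (a + s)) (_root_.deriv g (a + s)) s :=
      (hg.hasDerivAt (a + s)).comp_const_add a s
    have e2 := (hasDerivAt_id s).mul_const (_root_.deriv g a)
    exact (e1.sub e2).congr_deriv (by simp)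
  have := Convex.norm_image_sub_le_of_norm_hasDerivWithin_le (s := Set.uIcc 0 h) (C := C * |h|)
      (x := 0) (y := h) (fun x _ => (h2 x).hasDerivWithinAt)
      (fun x hx => (h1 x).trans (by
        have := Set.abs_sub_left_of_mem_uIcc hx
        simp only [sub_zero] at this
        gcongr)) (convex_uIcc 0 h) Set.left_mem_uIcc Set.right_mem_uIcc
  simp only [Real.norm_eq_abs, add_zero, zero_mul, sub_zero] at this
  calc |g (a + h) - g a - h * _root_.deriv g a| = |g (a + h) - h * _root_.deriv g a - g a| := by
        congr 1; ring
    _ ≤ C * |h| * |h| := this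
    _ = C * h ^ 2 := by rw [mul_assoc, abs_mul_abs_self, sq]

end IsProfile

/-- The kernel convolution with the profile translated by `t`, as an element of `L²(ℝ³)`. -/
noncomputable def shiftConv (hg : IsProfile g) (hφ : IsTest φ) (t : ℝ) : L2 :=
  ((hg.shift t).isTest_kernConv hφ).toL2

lemma norm_toL2_kernConv_le (hφ : IsTest φ) (N : ℝ) : ∃ D, 0 ≤ D ∧ ∀ (g : ℝ → ℝ)
    (hg : IsProfile g) (A : ℝ), (∀ r, N ≤ r → g r = 0) → (∀ r, 0 ≤ r → |g r| ≤ A) →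
      ‖(hg.isTest_kernConv hφ).toL2‖ ≤ A * D := by
  obtain ⟨ρ, -, hρ⟩ := hφ.zero_outside_ball
  obtain ⟨B, hB⟩ := hφ.bounded
  have hB0 : 0 ≤ B := (norm_nonneg _).trans (hB 0)
  have hI : 0 ≤ ∫ y : R3, kern (tent N) y :=
    integral_nonneg fun y => div_nonneg (tent_nonneg _ _) (norm_nonneg _)
  refine ⟨(B * ∫ y : R3, kern (tent N) y) *
    ((volume (ball (0 : R3) (N + ρ))) ^ (1 / 2 : ℝ)).toReal, by positivity,
    fun g hg A hN hA => ?_⟩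
  rw [← mul_assoc]
  refine norm_toL2_le _ (norm_kernConv_le hN hB0 hA hB) fun x hx => kernConv_eq_zero fun y hy => ?_
  refine hN _ ?_
  by_contra hc
  refine hy (hρ _ ?_)
  have := norm_sub_norm_le x y
  linarith

/-- Translating the profile is differentiable in `L²(ℝ³)`, with the expected derivative. -/
lemma hasDerivAt_shiftConv (hg : IsProfile g) (hφ : IsTest φ) (t : ℝ) :
    HasDerivAt (shiftConv hg hφ) (shiftConv hg.deriv hφ t) t := by
  obtain ⟨C, hC0, hC⟩ := hg.taylor
  obtain ⟨N, hN0, hN⟩ := hg.exists_zero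
  obtain ⟨N', hN0', hN'⟩ := hg.deriv.exists_zero
  obtain ⟨D, hD0, hD⟩ := norm_toL2_kernConv_le hφ (max N N' + |t| + 1)
  have key : ∀ s, |s - t| ≤ 1 → ‖shiftConv hg hφ s - shiftConv hg hφ t -
      (s - t) • shiftConv hg.deriv hφ t‖ ≤ C * D * ‖(s - t) ^ 2‖ := fun s hs => by
    have hp : IsProfile (fun r => g (r + s) + ((-1) * g (r + t) + (-(s - t)) * deriv g (r + t))) :=
      ⟨(hg.shift s).1.add ((contDiff_const.mul (hg.shift t).1).add
        (contDiff_const.mul (hg.deriv.shift t).1)),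
       (hg.shift s).2.add (((hg.shift t).2.mul_left).add ((hg.deriv.shift t).2.mul_left))⟩
    have hz : ∀ r, max N N' + |t| + 1 ≤ r → g (r + s) = 0 ∧ g (r + t) = 0 ∧
        deriv g (r + t) = 0 := fun r hr => by
      have h1 := le_max_left N N'
      have h2 := le_max_right N N'
      have h3 := neg_abs_le t
      have h4 := (abs_le.1 hs).1
      exact ⟨hN _ (le_trans (by linarith) (le_abs_self _)),
        hN _ (le_trans (by linarith) (le_abs_self _)),
        hN' _ (le_trans (by linarith) (le_abs_self _))⟩
    have e : shiftConv hg hφ s - shiftConv hg hφ t - (s - t) • shiftConv hg.deriv hφ t =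
        (hp.isTest_kernConv hφ).toL2 := by
      unfold shiftConv IsTest.toL2
      rw [← MemLp.toLp_sub, ← MemLp.toLp_const_smul, ← MemLp.toLp_sub]
      congr 1
      funext x
      rw [kernConv_add (N := max N N' + |t| + 1) (hg.shift s).1.continuous
        (fun r hr => (hz r hr).1)
        ((contDiff_const.mul (hg.shift t).1).add
          (contDiff_const.mul (hg.deriv.shift t).1)).continuous
        (fun r hr => by rw [(hz r hr).2.1, (hz r hr).2.2]; simp) hφ,
        kernConv_add (N := max N N' + |t| + 1) (contDiff_const.mul (hg.shift t).1).continuous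
        (fun r hr => by rw [(hz r hr).2.1]; simp)
        (contDiff_const.mul (hg.deriv.shift t).1).continuous
        (fun r hr => by rw [(hz r hr).2.2]; simp) hφ, kernConv_const_mul, kernConv_const_mul]
      simp only [Pi.sub_apply, Pi.smul_apply, neg_smul, one_smul]
      ring
    rw [e]
    refine (hD _ hp (C * (s - t) ^ 2) (fun r hr => ?_) fun r _ => ?_).trans (le_of_eq ?_)
    · obtain ⟨h1, h2, h3⟩ := hz r hr
      rw [h1, h2, h3]
      simp
    · have := hC (r + t) (s - t)
      rw [show r + t + (s - t) = r + s by ring] at this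
      convert this using 2
      ring
    · rw [Real.norm_of_nonneg (sq_nonneg _)]
      ring
  rw [hasDerivAt_iff_isLittleO]
  have h1 : (fun s => shiftConv hg hφ s - shiftConv hg hφ t - (s - t) • shiftConv hg.deriv hφ t)
      =O[𝓝 t] fun s => (s - t) ^ 2 := by
    refine Asymptotics.IsBigO.of_bound (C * D) ?_
    filter_upwards [Metric.closedBall_mem_nhds t one_pos] with s hs
    exact key s (by simpa [Real.dist_eq] using hs)
  have h2 : (fun s : ℝ => (s - t) ^ 2) =o[𝓝 t] fun s => s - t := by
    have h3 : Tendsto (fun s : ℝ => s - t) (𝓝 t) (𝓝 0) := by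
      have : Continuous fun s : ℝ => s - t := by fun_prop
      simpa using this.tendsto t
    have := (Asymptotics.isLittleO_pow_id (𝕜 := ℝ) one_lt_two).comp_tendsto h3
    exact this
  exact h1.trans_isLittleO h2

end Profile

/-! ### Finite speed of propagation and the Huygens principle -/

namespace IsWaveSolution

variable {T : ℝ} {F : L2} {u : ℝ → L2} {g : ℝ → ℝ} {φ : R3 → ℂ}

lemma continuousOn (hu : IsWaveSolution T F u) : ContinuousOn u (Set.Icc 0 T) :=
  hu.contDiffOn.continuousOn

lemma hasDerivWithinAt (hu : IsWaveSolution T F u) {t : ℝ} (ht : t ∈ Set.Icc 0 T) :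
    HasDerivWithinAt u (timeDeriv T u t) (Set.Icc 0 T) t :=
  (hu.contDiffOn.differentiableOn (by simp) t ht).hasDerivWithinAt

lemma continuousOn_timeDeriv (hu : IsWaveSolution T F u) (hT : 0 < T) :
    ContinuousOn (timeDeriv T u) (Set.Icc 0 T) :=
  hu.contDiffOn.continuousOn_derivWithin (uniqueDiffOn_Icc hT) (by simp)

lemma hasDerivAt (hu : IsWaveSolution T F u) {t : ℝ} (ht : t ∈ Set.Ioo 0 T) :
    HasDerivAt u (timeDeriv T u t) t :=
  (hu.hasDerivWithinAt (Set.Ioo_subset_Icc_self ht)).hasDerivAt (Icc_mem_nhds ht.1 ht.2)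

lemma continuousOn_integral (hu : IsWaveSolution T F u) (hφ : IsTest φ) :
    ContinuousOn (fun t => ∫ x, u t x * φ x) (Set.Icc 0 T) := by
  simp_rw [← pairing_toL2 _ hφ]
  exact (pairing.flip hφ.toL2).continuous.comp_continuousOn hu.continuousOn

lemma hasDerivAt_integral (hu : IsWaveSolution T F u) (hφ : IsTest φ) {t : ℝ}
    (ht : t ∈ Set.Ioo 0 T) :
    HasDerivAt (fun t => ∫ x, u t x * φ x) (∫ x, timeDeriv T u t x * φ x) t := by
  simp_rw [← pairing_toL2 _ hφ]
  exact (pairing.flip hφ.toL2).hasFDerivAt.comp_hasDerivAt t (hu.hasDerivAt ht)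

end IsWaveSolution

/-- A product rule in which the first factor is only continuous, but weakly differentiable against
the value of the second factor. -/
lemma hasDerivAt_pairing_weak {v ψ : ℝ → L2} {ψ' : L2} {a : ℂ} {t : ℝ} (hv : ContinuousAt v t)
    (hψ : HasDerivAt ψ ψ' t) (hw : HasDerivAt (fun s => pairing (v s) (ψ t)) a t) :
    HasDerivAt (fun s => pairing (v s) (ψ s)) (a + pairing (v t) ψ') t := by
  have h1 : HasDerivAt (fun s => pairing (v s) (ψ s - ψ t)) (pairing (v t) ψ') t := by
    rw [hasDerivAt_iff_tendsto_slope]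
    have h2 : Tendsto (fun s => pairing (v s) (slope ψ t s)) (𝓝[≠] t) (𝓝 (pairing (v t) ψ')) :=
      (isBoundedBilinearMap_apply.continuous.tendsto (pairing (v t), ψ')).comp
        (((pairing.continuous.tendsto (v t)).comp
          (hv.tendsto.mono_left nhdsWithin_le_nhds)).prodMk_nhds
          (hasDerivAt_iff_tendsto_slope.1 hψ))
    refine h2.congr fun s => ?_
    simp [slope_def_module]
  refine (hw.add h1).congr_of_eventuallyEq (Eventually.of_forall fun s => ?_)
  simp

namespace IsWaveSolution

variable {T : ℝ} {F : L2} {u : ℝ → L2} {g : ℝ → ℝ} {φ : R3 → ℂ}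

/-- The quantity `∫ (∂ₜu ψ - u ∂ₜψ)`, where `ψ` is the kernel convolution with the profile
translated by `t`. -/
noncomputable def flux (T : ℝ) (u : ℝ → L2) (hg : IsProfile g) (hφ : IsTest φ) (t : ℝ) : ℂ :=
  pairing (timeDeriv T u t) (shiftConv hg hφ t) - pairing (u t) (shiftConv hg.deriv hφ t)

lemma hasDerivAt_flux (hu : IsWaveSolution T F u) (hg : IsProfile g) (hφ : IsTest φ) {t : ℝ}
    (ht : t ∈ Set.Ioo 0 T) :
    HasDerivAt (flux T u hg hφ) (-((sphConst * g t) • ∫ x, u t x * φ x)) t := by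
  have hT : 0 < T := ht.1.trans ht.2
  have hc : ContinuousAt (timeDeriv T u) t :=
    (hu.continuousOn_timeDeriv hT).continuousAt (Icc_mem_nhds ht.1 ht.2)
  have hw : HasDerivAt (fun s => pairing (timeDeriv T u s) (shiftConv hg hφ t))
      (∫ x, u t x * Laplacian.laplacian (kernConv (fun r => g (r + t)) φ) x) t := by
    have h1 := hu.wave_equation _ ((hg.shift t).isTest_kernConv hφ) t ht
    refine h1.congr_of_eventuallyEq (Eventually.of_forall fun s => ?_)
    exact pairing_toL2 _ _
  have h1 := hasDerivAt_pairing_weak hc (hasDerivAt_shiftConv hg hφ t) hw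
  have h2 := pairing.hasDerivAt_of_bilinear (x := t) (fun _ => hu.hasDerivAt ht)
    (fun _ => hasDerivAt_shiftConv hg.deriv hφ t)
  refine (h1.sub h2).congr_deriv ?_
  have e : ∫ x, u t x * Laplacian.laplacian (kernConv (fun r => g (r + t)) φ) x =
      pairing (u t) (shiftConv hg.deriv.deriv hφ t) - (sphConst * g t) • ∫ x, u t x * φ x := by
    have hk := (hg.deriv.deriv.shift t).isTest_kernConv hφ
    have e1 : ∀ x, u t x * Laplacian.laplacian (kernConv (fun r => g (r + t)) φ) x =
        u t x * kernConv (fun r => deriv (deriv g) (r + t)) φ x -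
          (sphConst * g t) • (u t x * φ x) := fun x => by
      obtain ⟨N, -, hN⟩ := (hg.shift t).exists_zero
      have hd : deriv (deriv fun r => g (r + t)) = fun r => deriv (deriv g) (r + t) := by
        have : (deriv fun r => g (r + t)) = fun r => deriv g (r + t) :=
          funext fun r => deriv_comp_add_const _ _ _
        rw [this]
        exact funext fun r => deriv_comp_add_const _ _ _
      rw [laplacian_kernConv (hg.shift t).1 (fun r hr => hN r (hr.trans (le_abs_self r))) hφ, hd,
        zero_add, mul_sub, mul_smul_comm]
    simp_rw [e1]
    have hi : Integrable (fun x => (sphConst * g t) • (u t x * φ x)) :=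
      (integrable_mul_test (u t) hφ).smul (sphConst * g t)
    rw [integral_sub (integrable_mul_test _ hk) hi,
      integral_smul, shiftConv, pairing_toL2]
  rw [e]
  ring

lemma continuousOn_flux (hu : IsWaveSolution T F u) (hT : 0 < T) (hg : IsProfile g)
    (hφ : IsTest φ) : ContinuousOn (flux T u hg hφ) (Set.Icc 0 T) := by
  have hc : ∀ {g : ℝ → ℝ} (hg : IsProfile g), Continuous (shiftConv hg hφ) := fun hg =>
    continuous_iff_continuousAt.2 fun t => (hasDerivAt_shiftConv hg hφ t).continuousAt
  exact ((pairing.continuous.comp_continuousOn (hu.continuousOn_timeDeriv hT)).clm_apply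
    (hc hg).continuousOn).sub ((pairing.continuous.comp_continuousOn hu.continuousOn).clm_apply
      (hc hg.deriv).continuousOn)

/-- Kirchhoff's formula in integrated form: against a test function, the solution at time `t` is
the spherical mean of the initial velocity over spheres of radius `t`. -/
theorem kirchhoff (hu : IsWaveSolution T F u) (hT : 0 < T) (hg : IsProfile g) (hφ : IsTest φ)
    {T' : ℝ} (hT' : T' < T) (hgT : ∀ r, T' ≤ r → g r = 0) :
    ∫ t in (0)..T, (sphConst * g t) • ∫ x, u t x * φ x = ∫ x, F x * kernConv g φ x := by
  have hcont : ContinuousOn (fun t => -((sphConst * g t) • ∫ x, u t x * φ x)) (Set.Icc 0 T) :=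
    ((continuous_const.mul hg.1.continuous).continuousOn.smul (hu.continuousOn_integral hφ)).neg
  have h := intervalIntegral.integral_eq_sub_of_hasDerivAt_of_le hT.le
    (hu.continuousOn_flux hT hg hφ) (fun t ht => hu.hasDerivAt_flux hg hφ ht)
    (hcont.intervalIntegrable_of_Icc hT.le)
  -- At time `T` the translated profile vanishes on `[0, ∞)`, the only part the kernel sees.
  have hz : ∀ {g : ℝ → ℝ} (hg : IsProfile g), (∀ r, T ≤ r → g r = 0) → shiftConv hg hφ T = 0 := by
    intro g hg hgT
    have e : kernConv (fun r => g (r + T)) φ = 0 := by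
      funext x
      refine kernConv_eq_zero fun y _ => hgT _ ?_
      have := norm_nonneg y
      linarith
    unfold shiftConv IsTest.toL2
    simp_rw [e]
    exact MemLp.toLp_zero _
  have h0 : flux T u hg hφ 0 = ∫ x, F x * kernConv g φ x := by
    have e : (fun r => g (r + 0)) = g := by simp
    rw [flux, hu.initial_value, hu.initial_velocity, map_zero, zero_apply, sub_zero, shiftConv,
      pairing_toL2]
    simp_rw [e]
  have h1 : flux T u hg hφ T = 0 := by
    rw [flux, hz hg fun r hr => hgT r (hT'.le.trans hr),
      hz hg.deriv fun r hr => deriv_eq_zero_of_lt hgT (hT'.trans_le hr)]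
    simp
  rw [intervalIntegral.integral_neg, h0, h1, zero_sub, neg_inj] at h
  exact h

/-- Finite speed of propagation together with the strong Huygens principle: waves issued from the
ball of radius `ε` reach the ball of radius `ρ` around `x₀` only at times `t` with
`|t - ‖x₀‖| ≤ ε + ρ`. -/
theorem integral_eq_zero (hu : IsWaveSolution T F u) (hT : 0 < T) {ε : ℝ}
    (hF : ∀ᵐ x, ε < ‖x‖ → F x = 0) (hφ : IsTest φ) {x₀ : R3} {ρ : ℝ}
    (hρ : ∀ x, ρ ≤ ‖x - x₀‖ → φ x = 0) {t : ℝ} (ht : t ∈ Set.Icc 0 T)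
    (htx : ε + ρ < |t - ‖x₀‖|) : ∫ x, u t x * φ x = 0 := by
  set U : Set ℝ := Set.Ioo 0 T ∩ {t | ε + ρ < |t - ‖x₀‖|} with hU
  have hopen : IsOpen {t : ℝ | ε + ρ < |t - ‖x₀‖|} :=
    isOpen_lt continuous_const (by fun_prop)
  have hUo : IsOpen U := isOpen_Ioo.inter hopen
  have hc := hu.continuousOn_integral hφ
  have hcU : ContinuousOn (fun t => ∫ x, u t x * φ x) U :=
    hc.mono fun t ht => Set.Ioo_subset_Icc_self ht.1
  have hae : ∀ᵐ t : ℝ, t ∈ U → ∫ x, u t x * φ x = 0 := by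
    refine hUo.ae_eq_zero_of_integral_contDiff_smul_eq_zero
      (hcU.locallyIntegrableOn hUo.measurableSet) fun g hg hgc hgU => ?_
    have hp : IsProfile g := ⟨hg, hgc⟩
    have hg0 : ∀ r, r ∉ U → g r = 0 := fun r hr =>
      image_eq_zero_of_notMem_tsupport fun h => hr (hgU h)
    obtain ⟨T', hT'T, hT'⟩ : ∃ T' < T, ∀ r, T' ≤ r → g r = 0 := by
      rcases (tsupport g).eq_empty_or_nonempty with h | h
      · exact ⟨T - 1, by linarith, fun r _ => image_eq_zero_of_notMem_tsupport (by simp [h])⟩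
      · have hm := hgc.isCompact.sSup_mem h
        refine ⟨(sSup (tsupport g) + T) / 2, by linarith [(hgU hm).1.2], fun r hr => ?_⟩
        refine image_eq_zero_of_notMem_tsupport fun h' => ?_
        have := le_csSup hgc.isCompact.bddAbove h'
        linarith [(hgU hm).1.2]
    have hk := hu.kirchhoff hT hp hφ hT'T hT'
    have hR : ∫ x, F x * kernConv g φ x = 0 := by
      rw [← integral_zero R3 ℂ]
      refine integral_congr_ae ?_
      filter_upwards [hF] with x hx
      rcases lt_or_ge ε ‖x‖ with h | h
      · rw [hx h, zero_mul]
      · rw [kernConv_eq_zero fun y hy => hg0 _ fun hyU => ?_, mul_zero]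
        refine hy (hρ _ ?_)
        have h1 : |‖y‖ - ‖x₀‖| ≤ ‖y + x₀‖ := by
          have := abs_norm_sub_norm_le y (-x₀)
          simpa using this
        have h2 : ‖y + x₀‖ ≤ ‖x‖ + ‖x - y - x₀‖ := by
          have := norm_sub_le x (x - y - x₀)
          rwa [show x - (x - y - x₀) = y + x₀ by abel] at this
        have h3 := hyU.2
        simp only [Set.mem_ofPred_eq] at h3
        linarith
    rw [hR] at hk
    simp_rw [mul_smul] at hk
    rw [intervalIntegral.integral_smul, smul_eq_zero] at hk
    have hk' := hk.resolve_left sphConst_pos.ne'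
    rw [intervalIntegral.integral_of_le hT.le, setIntegral_eq_integral_of_forall_compl_eq_zero] at hk'
    · exact hk'
    · intro r hr
      rw [hg0 r fun h => hr ⟨h.1.1, h.1.2.le⟩, zero_smul]
  have hUz : Set.EqOn (fun t => ∫ x, u t x * φ x) (fun _ => 0) U :=
    Measure.eqOn_open_of_ae_eq ((ae_restrict_iff' hUo.measurableSet).2 hae) hUo hcU
      continuousOn_const
  -- Continuity in time extends the conclusion to the endpoints `0` and `T`.
  have hcl : t ∈ closure U := by
    have h1 : t ∈ closure (Set.Ioo 0 T) := by rwa [closure_Ioo hT.ne]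
    rw [hU, Set.inter_comm]
    exact hopen.inter_closure ⟨htx, h1⟩
  have hz : closure U ⊆ Set.Icc 0 T := by
    refine (closure_mono Set.inter_subset_left).trans ?_
    rw [closure_Ioo hT.ne]
  exact hUz.of_subset_closure (hc.mono hz) continuousOn_const subset_closure le_rfl hcl

/-- The same localisation for the velocity at the final time. -/
theorem integral_timeDeriv_eq_zero (hu : IsWaveSolution T F u) (hT : 0 < T) {ε : ℝ}
    (hF : ∀ᵐ x, ε < ‖x‖ → F x = 0) (hφ : IsTest φ) {x₀ : R3} {ρ : ℝ}
    (hρ : ∀ x, ρ ≤ ‖x - x₀‖ → φ x = 0) (htx : ε + ρ < |T - ‖x₀‖|) :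
    ∫ x, timeDeriv T u T x * φ x = 0 := by
  have hT' : T ∈ Set.Icc 0 T := ⟨hT.le, le_rfl⟩
  have h1 : HasDerivWithinAt (fun t => pairing (u t) hφ.toL2)
      (pairing (timeDeriv T u T) hφ.toL2) (Set.Icc 0 T) T :=
    (pairing.flip hφ.toL2).hasFDerivAt.comp_hasDerivWithinAt T (hu.hasDerivWithinAt hT')
  have hopen : IsOpen {t : ℝ | ε + ρ < |t - ‖x₀‖|} :=
    isOpen_lt continuous_const (by fun_prop)
  have h2 : (fun t => pairing (u t) hφ.toL2) =ᶠ[𝓝[Set.Icc 0 T] T] fun _ => 0 := by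
    filter_upwards [self_mem_nhdsWithin, mem_nhdsWithin_of_mem_nhds (hopen.mem_nhds htx)]
      with t ht ht'
    rw [pairing_toL2]
    exact hu.integral_eq_zero hT hF hφ hρ ht ht'
  have h3 : HasDerivWithinAt (fun t => pairing (u t) hφ.toL2) 0 (Set.Icc 0 T) T :=
    (hasDerivWithinAt_const T _ (0 : ℂ)).congr_of_eventuallyEq h2 (h2.self_of_nhdsWithin hT')
  rw [← pairing_toL2 _ hφ]
  exact (uniqueDiffOn_Icc hT T hT').eq_deriv _ h1 h3

end IsWaveSolution

/-! ### Weyl's lemma for the Helmholtz equation -/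

section Weyl

/-- Locally integrable solutions of `(Δ + k²) h = 0` on `ℝ³`, in the sense of distributions. -/
structure IsWeakHelmholtz (k : ℝ) (h : R3 → ℂ) : Prop where
  locallyIntegrable : LocallyIntegrable h
  eq_zero : ∀ φ, IsTest φ → ∫ x, h x * (Laplacian.laplacian φ x + (k : ℂ) ^ 2 * φ x) = 0

variable {k R N : ℝ} {h : R3 → ℂ} {g γ : ℝ → ℝ} {φ : R3 → ℂ}

lemma integrable_mul_of_isTest (hh : LocallyIntegrable h) (hφ : IsTest φ) :
    Integrable (fun x => h x * φ x) := by
  have := hh.integrable_smul_left_of_hasCompactSupport hφ.continuous hφ.2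
  simpa [mul_comm] using this

lemma contDiff_kern (hγ : ContDiff ℝ ∞ γ) (hR : 0 < R) (h0 : ∀ r, r ≤ R → γ r = 0) :
    ContDiff ℝ ∞ (kern γ) := by
  rw [contDiff_iff_contDiffAt]
  intro y
  by_cases hy : y = 0
  · have : kern γ =ᶠ[𝓝 y] fun _ => 0 := by
      filter_upwards [Metric.ball_mem_nhds y hR] with z hz
      rw [hy, mem_ball_zero_iff] at hz
      rw [kern, h0 _ hz.le, zero_div]
    exact contDiffAt_const.congr_of_eventuallyEq this
  · have hn : ContDiffAt ℝ ∞ (fun z : R3 => ‖z‖) y := contDiffAt_norm ℝ hy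
    exact (hγ.contDiffAt.comp y hn).div hn (norm_ne_zero_iff.2 hy)

lemma kern_hasCompactSupport (hN : ∀ r, N ≤ r → γ r = 0) : HasCompactSupport (kern γ) := by
  refine HasCompactSupport.of_support_subset_isCompact (isCompact_closedBall 0 N) fun x hx => ?_
  by_contra hn
  rw [mem_closedBall_zero_iff, not_le] at hn
  exact hx (by rw [kern, hN _ hn.le, zero_div])

lemma contDiff_kernConv_left (hγ : ContDiff ℝ ∞ γ) (hR : 0 < R) (h0 : ∀ r, r ≤ R → γ r = 0)
    (hN : ∀ r, N ≤ r → γ r = 0) (hh : LocallyIntegrable h) : ContDiff ℝ ∞ (kernConv γ h) :=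
  (kern_hasCompactSupport hN).contDiff_convolution_left (n := ⊤)
    (ContinuousLinearMap.lsmul ℝ ℝ) (contDiff_kern hγ hR h0) hh

lemma kern_sub_comm (γ : ℝ → ℝ) (x y : R3) : kern γ (x - y) = kern γ (y - x) := by
  rw [kern, kern, norm_sub_rev]

lemma kernConv_eq_integral_sub (γ : ℝ → ℝ) (h : R3 → ℂ) (x : R3) :
    kernConv γ h x = ∫ y, kern γ (x - y) • h y := by
  rw [kernConv, ← integral_sub_left_eq_self _ volume x]
  simp

/-- Convolution with a smooth radial kernel is symmetric. -/
lemma integral_mul_kernConv (hγ : ContDiff ℝ ∞ γ) (hR : 0 < R) (h0 : ∀ r, r ≤ R → γ r = 0)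
    (hN : ∀ r, N ≤ r → γ r = 0) (hh : LocallyIntegrable h) (hφ : IsTest φ) :
    ∫ x, h x * kernConv γ φ x = ∫ x, kernConv γ h x * φ x := by
  obtain ⟨ρ, -, hρ⟩ := hφ.zero_outside_ball
  have hkc := (contDiff_kern hγ hR h0).continuous
  obtain ⟨C, hC⟩ := hkc.bounded_above_of_compact_support (kern_hasCompactSupport hN)
  -- Only the values of `h` in a fixed ball matter, which makes Fubini's theorem applicable.
  set h' : R3 → ℂ := (closedBall (0 : R3) (N + ρ)).indicator h
  have hi : Integrable h' :=
    (hh.integrableOn_isCompact (isCompact_closedBall _ _)).integrable_indicator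
      measurableSet_closedBall
  have hkey : ∀ x y, h x * (kern γ (x - y) • φ y) = (h' x * φ y) * (kern γ (x - y) : ℂ) := by
    intro x y
    by_cases hx : x ∈ closedBall (0 : R3) (N + ρ)
    · rw [show h' x = h x from Set.indicator_of_mem hx _, Complex.real_smul]
      ring
    · rw [show h' x = 0 from Set.indicator_of_notMem hx _, zero_mul, zero_mul]
      rw [mem_closedBall_zero_iff, not_le] at hx
      by_cases hy : ρ ≤ ‖y‖
      · rw [hρ y hy, smul_zero, mul_zero]
      · have := norm_sub_norm_le x y
        rw [kern, hN _ (by linarith), zero_div, zero_smul, mul_zero]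
  have hint : Integrable (Function.uncurry fun x y => h x * (kern γ (x - y) • φ y))
      ((volume : Measure R3).prod volume) := by
    have h1 := (hi.mul_prod hφ.integrable).mul_bdd (c := C)
      (g := fun z : R3 × R3 => (kern γ (z.1 - z.2) : ℂ))
      (by
        refine Continuous.aestronglyMeasurable ?_
        exact Complex.continuous_ofReal.comp (hkc.comp (continuous_fst.sub continuous_snd)))
      (Eventually.of_forall fun z => by rw [Complex.norm_real]; exact hC _)
    refine h1.congr (Eventually.of_forall fun z => ?_)
    exact (hkey z.1 z.2).symm
  simp_rw [kernConv_eq_integral_sub, ← integral_const_mul, ← integral_mul_const]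
  rw [integral_integral_swap hint]
  refine integral_congr_ae (Eventually.of_forall fun y => ?_)
  refine integral_congr_ae (Eventually.of_forall fun x => ?_)
  simp only [kern_sub_comm γ x y, Complex.real_smul]
  ring

/-- A weak solution is reproduced, up to the constant `4π g(0)`, by the radial kernel with
profile `g'' + k² g`. -/
lemma IsWeakHelmholtz.reproduce (hh : IsWeakHelmholtz k h) (hg : ContDiff ℝ ∞ g)
    (hN : ∀ r, N ≤ r → g r = 0) (hφ : IsTest φ) :
    ((sphConst * g 0 : ℝ) : ℂ) * ∫ x, h x * φ x =
      ∫ x, h x * kernConv (fun r => deriv (deriv g) r + k ^ 2 * g r) φ x := by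
  have hg1 : ContDiff ℝ ∞ (deriv g) := (contDiff_infty_iff_deriv.1 hg).2
  have hg2 : ContDiff ℝ ∞ (deriv (deriv g)) := (contDiff_infty_iff_deriv.1 hg1).2
  have hN1 : ∀ r, N + 1 ≤ r → deriv g r = 0 := fun r hr => deriv_eq_zero_of_lt hN (by linarith)
  have hN2 : ∀ r, N + 2 ≤ r → deriv (deriv g) r = 0 := fun r hr =>
    deriv_eq_zero_of_lt hN1 (by linarith)
  have hN0 : ∀ r, N + 2 ≤ r → k ^ 2 * g r = 0 := fun r hr => by
    rw [hN r (by linarith), mul_zero]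
  have hk := kernConv_isTest hg.continuous hN hφ
  have hγ := kernConv_isTest (g := fun r => deriv (deriv g) r + k ^ 2 * g r)
    (hg2.continuous.add (continuous_const.mul hg.continuous)) (N := N + 2)
    (fun r hr => by rw [hN2 r hr, hN0 r hr, add_zero]) hφ
  have hcont : Continuous fun r => k ^ 2 * g r := continuous_const.mul hg.continuous
  have h1 := hh.eq_zero _ hk
  have e : ∀ x, h x * (Laplacian.laplacian (kernConv g φ) x + (k : ℂ) ^ 2 * kernConv g φ x) =
      h x * kernConv (fun r => deriv (deriv g) r + k ^ 2 * g r) φ x -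
        ((sphConst * g 0 : ℝ) : ℂ) * (h x * φ x) := fun x => by
    rw [laplacian_kernConv hg hN hφ, kernConv_add (N := N + 2) hg2.continuous hN2
      hcont hN0 hφ, kernConv_const_mul, Complex.real_smul,
      Complex.real_smul]
    push_cast
    ring
  simp_rw [e] at h1
  rw [integral_sub (integrable_mul_of_isTest hh.1 hγ)
    ((integrable_mul_of_isTest hh.1 hφ).const_mul _), integral_const_mul, sub_eq_zero] at h1
  exact h1.symm

/-- A smooth cutoff: one on `(-∞, 0]` and zero on `[1, ∞)`. -/
noncomputable def cutoff (s : ℝ) : ℝ := Real.smoothTransition (1 - s)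

lemma contDiff_cutoff : ContDiff ℝ ∞ cutoff :=
  Real.smoothTransition.contDiff.comp (contDiff_const.sub contDiff_id)

lemma cutoff_eq_one {s : ℝ} (hs : s ≤ 0) : cutoff s = 1 :=
  Real.smoothTransition.one_of_one_le (by linarith)

lemma cutoff_eq_zero {s : ℝ} (hs : 1 ≤ s) : cutoff s = 0 :=
  Real.smoothTransition.zero_of_nonpos (by linarith)

lemma contDiff_deriv_cutoff : ContDiff ℝ ∞ (deriv cutoff) :=
  (contDiff_infty_iff_deriv.1 contDiff_cutoff).2

lemma contDiff_deriv_deriv_cutoff : ContDiff ℝ ∞ (deriv (deriv cutoff)) :=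
  (contDiff_infty_iff_deriv.1 contDiff_deriv_cutoff).2

lemma deriv_eq_zero_of_const_left {f : ℝ → ℝ} (hf : Continuous (deriv f)) {a c : ℝ}
    (h : ∀ s < a, f s = c) {s : ℝ} (hs : s ≤ a) : deriv f s = 0 := by
  have h1 : Set.EqOn (deriv f) (fun _ => 0) (Set.Iio a) := fun r hr => by
    have : f =ᶠ[𝓝 r] fun _ => c := by
      filter_upwards [Iio_mem_nhds hr] with s hs using h s hs
    rw [this.deriv_eq, deriv_const]
  have h2 := h1.closure hf continuous_const
  rw [closure_Iio] at h2
  exact h2 hs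

lemma deriv_cutoff_of_le {s : ℝ} (hs : s ≤ 0) : deriv cutoff s = 0 :=
  deriv_eq_zero_of_const_left contDiff_deriv_cutoff.continuous (fun _ hs => cutoff_eq_one hs.le) hs

lemma deriv_deriv_cutoff_of_le {s : ℝ} (hs : s ≤ 0) : deriv (deriv cutoff) s = 0 :=
  deriv_eq_zero_of_const_left contDiff_deriv_deriv_cutoff.continuous
    (fun _ hs => deriv_cutoff_of_le hs.le) hs

lemma deriv_cutoff_of_lt {s : ℝ} (hs : 1 < s) : deriv cutoff s = 0 :=
  deriv_eq_zero_of_lt (fun _ hr => cutoff_eq_zero hr) hs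

lemma deriv_deriv_cutoff_of_lt {s : ℝ} (hs : 1 < s) : deriv (deriv cutoff) s = 0 := by
  have : deriv cutoff =ᶠ[𝓝 s] fun _ => 0 := by
    filter_upwards [Ioi_mem_nhds hs] with r hr using deriv_cutoff_of_lt hr
  rw [this.deriv_eq, deriv_const]

/-- The profile `g'' + k² g` for `g(r) = cutoff (r - R) cos (k r)`. -/
noncomputable def shellProfile (k R r : ℝ) : ℝ :=
  deriv (deriv cutoff) (r - R) * Real.cos (k * r) -
    2 * k * (deriv cutoff (r - R) * Real.sin (k * r))

lemma contDiff_shellProfile (k R : ℝ) : ContDiff ℝ ∞ (shellProfile k R) := by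
  have h0 : ContDiff ℝ ∞ (fun r : ℝ => r - R) := contDiff_id.sub contDiff_const
  have h1 : ContDiff ℝ ∞ (fun r : ℝ => k * r) := contDiff_const.mul contDiff_id
  exact ((contDiff_deriv_deriv_cutoff.comp h0).mul (Real.contDiff_cos.comp h1)).sub
    (contDiff_const.mul ((contDiff_deriv_cutoff.comp h0).mul (Real.contDiff_sin.comp h1)))

lemma shellProfile_of_le {r : ℝ} (hr : r ≤ R) : shellProfile k R r = 0 := by
  rw [shellProfile, deriv_cutoff_of_le (by linarith), deriv_deriv_cutoff_of_le (by linarith)]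
  simp

lemma shellProfile_of_lt {r : ℝ} (hr : R + 1 < r) : shellProfile k R r = 0 := by
  rw [shellProfile, deriv_cutoff_of_lt (by linarith), deriv_deriv_cutoff_of_lt (by linarith)]
  simp

/-- The profiles of the shell kernels are bounded uniformly in the radius of the shell. -/
lemma exists_shellProfile_bound (k : ℝ) : ∃ C, 0 ≤ C ∧ ∀ R r, |shellProfile k R r| ≤ C := by
  have hb : ∀ {f : ℝ → ℝ}, Continuous f → (∀ s ≤ 0, f s = 0) → (∀ s, 1 < s → f s = 0) →
      ∃ C, ∀ s, |f s| ≤ C := fun {f} hf h0 h1 => by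
    refine hf.bounded_above_of_compact_support
      (HasCompactSupport.of_support_subset_isCompact (isCompact_Icc (a := 0) (b := 1)) ?_)
    intro s hs
    by_contra hn
    rcases le_or_gt s 0 with h | h
    · exact hs (h0 s h)
    · exact hs (h1 s (not_le.1 fun h' => hn ⟨h.le, h'⟩))
  obtain ⟨C₁, hC₁⟩ := hb contDiff_deriv_cutoff.continuous (fun s => deriv_cutoff_of_le)
    fun s => deriv_cutoff_of_lt
  obtain ⟨C₂, hC₂⟩ := hb contDiff_deriv_deriv_cutoff.continuous
    (fun s => deriv_deriv_cutoff_of_le) fun s => deriv_deriv_cutoff_of_lt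
  have h1 : 0 ≤ C₁ := (abs_nonneg _).trans (hC₁ 0)
  have h2 : 0 ≤ C₂ := (abs_nonneg _).trans (hC₂ 0)
  refine ⟨C₂ * 1 + |2 * k| * (C₁ * 1), by positivity, fun R r => ?_⟩
  refine (abs_sub _ _).trans ?_
  rw [abs_mul, abs_mul (2 * k), abs_mul (deriv cutoff _)]
  gcongr
  · exact hC₂ _
  · exact Real.abs_cos_le_one _
  · exact hC₁ _
  · exact Real.abs_sin_le_one _

lemma deriv_deriv_cutoff_mul_cos (k R : ℝ) :
    (fun r => deriv (deriv fun r => cutoff (r - R) * Real.cos (k * r)) r +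
      k ^ 2 * (cutoff (r - R) * Real.cos (k * r))) = shellProfile k R := by
  have d0 : ∀ r, HasDerivAt (fun r => cutoff (r - R)) (deriv cutoff (r - R)) r := fun r =>
    ((contDiff_cutoff.differentiable (by simp) _).hasDerivAt).comp_sub_const r R
  have d1 : ∀ r, HasDerivAt (fun r => deriv cutoff (r - R)) (deriv (deriv cutoff) (r - R)) r :=
    fun r => ((contDiff_deriv_cutoff.differentiable (by simp) _).hasDerivAt).comp_sub_const r R
  have dk : ∀ r, HasDerivAt (fun r => k * r) k r := fun r => by
    simpa using (hasDerivAt_id r).const_mul k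
  have dc : ∀ r, HasDerivAt (fun r => Real.cos (k * r)) (-Real.sin (k * r) * k) r :=
    fun r => (dk r).cos
  have ds : ∀ r, HasDerivAt (fun r => Real.sin (k * r)) (Real.cos (k * r) * k) r :=
    fun r => (dk r).sin
  have e1 : (deriv fun r => cutoff (r - R) * Real.cos (k * r)) = fun r =>
      deriv cutoff (r - R) * Real.cos (k * r) + cutoff (r - R) * (-Real.sin (k * r) * k) :=
    funext fun r => ((d0 r).mul (dc r)).deriv
  funext r
  have d2 : HasDerivAt (fun r => deriv cutoff (r - R) * Real.cos (k * r) +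
      cutoff (r - R) * (-Real.sin (k * r) * k)) _ r :=
    ((d1 r).mul (dc r)).add ((d0 r).mul ((ds r).neg.mul_const k))
  rw [e1, d2.deriv, shellProfile]
  ring

/-- A weak solution agrees, in the sense of distributions, with its averages over shells. -/
lemma IsWeakHelmholtz.integral_shell (hh : IsWeakHelmholtz k h) (hR : 0 < R) (hφ : IsTest φ) :
    (sphConst : ℂ) * ∫ x, h x * φ x = ∫ x, kernConv (shellProfile k R) h x * φ x := by
  have hg : ContDiff ℝ ∞ (fun r => cutoff (r - R) * Real.cos (k * r)) :=
    (contDiff_cutoff.comp (contDiff_id.sub contDiff_const)).mul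
      (Real.contDiff_cos.comp (contDiff_const.mul contDiff_id))
  have h1 := hh.reproduce hg (N := R + 1)
    (fun r hr => by rw [cutoff_eq_zero (by linarith), zero_mul]) hφ
  rw [deriv_deriv_cutoff_mul_cos, cutoff_eq_one (by linarith), mul_zero, Real.cos_zero, mul_one,
    mul_one] at h1
  rw [h1]
  exact integral_mul_kernConv (contDiff_shellProfile k R) hR (fun r => shellProfile_of_le)
    (N := R + 2) (fun r hr => shellProfile_of_lt (by linarith)) hh.1 hφ

lemma contDiff_shellConv (hh : LocallyIntegrable h) (hR : 0 < R) :
    ContDiff ℝ ∞ (kernConv (shellProfile k R) h) :=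
  contDiff_kernConv_left (contDiff_shellProfile k R) hR (fun r => shellProfile_of_le)
    (N := R + 2) (fun r hr => shellProfile_of_lt (by linarith)) hh

lemma isTest_ofReal {f : R3 → ℝ} (hf : ContDiff ℝ ∞ f) (hc : HasCompactSupport f) :
    IsTest (fun x => (f x : ℂ)) :=
  ⟨Complex.ofRealCLM.contDiff.comp hf, hc.comp_left (g := fun t : ℝ => (t : ℂ)) (by simp)⟩

lemma IsWeakHelmholtz.ae_eq_shell (hh : IsWeakHelmholtz k h) (hR : 0 < R) :
    ∀ᵐ x, (sphConst : ℂ) * h x = kernConv (shellProfile k R) h x := by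
  have hl : LocallyIntegrable (fun x => (sphConst : ℂ) * h x) := hh.1.smul (sphConst : ℂ)
  refine ae_eq_of_integral_contDiff_smul_eq hl
    (contDiff_shellConv hh.1 hR).continuous.locallyIntegrable fun f hf hc => ?_
  have h1 := hh.integral_shell hR (isTest_ofReal hf hc)
  rw [← integral_const_mul] at h1
  simp_rw [Complex.real_smul]
  rw [show (fun x => (f x : ℂ) * ((sphConst : ℂ) * h x)) = fun x => (sphConst : ℂ) *
    (h x * f x) by funext x; ring, h1]
  simp_rw [mul_comm]

/-- Weyl's lemma: weak solutions of the Helmholtz equation are smooth. -/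
theorem IsWeakHelmholtz.exists_contDiff (hh : IsWeakHelmholtz k h) :
    ∃ H : R3 → ℂ, ContDiff ℝ ∞ H ∧ (∀ᵐ x, h x = H x) ∧ IsWeakHelmholtz k H := by
  have hc : (sphConst : ℂ) ≠ 0 := by exact_mod_cast sphConst_pos.ne'
  -- Any radius of the shell will do here.
  have hs : ContDiff ℝ ∞ (fun x => (sphConst : ℂ)⁻¹ * kernConv (shellProfile k 1) h x) :=
    contDiff_const.mul (contDiff_shellConv hh.1 one_pos)
  have hae : ∀ᵐ x, h x = (sphConst : ℂ)⁻¹ * kernConv (shellProfile k 1) h x := by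
    filter_upwards [hh.ae_eq_shell one_pos] with x hx
    rw [← hx, inv_mul_cancel_left₀ hc]
  refine ⟨_, hs, hae, hs.continuous.locallyIntegrable, fun φ hφ => ?_⟩
  rw [← hh.eq_zero φ hφ]
  refine integral_congr_ae ?_
  filter_upwards [hae] with x hx
  rw [← hx]

/-- The shell formula holds at every point for continuous weak solutions. -/
lemma IsWeakHelmholtz.eq_shell (hh : IsWeakHelmholtz k h) (hc : Continuous h) (hR : 0 < R)
    (x : R3) : (sphConst : ℂ) * h x = kernConv (shellProfile k R) h x :=
  congrFun ((Continuous.ae_eq_iff_eq volume (continuous_const.mul hc)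
    (contDiff_shellConv hh.1 hR).continuous).1 (hh.ae_eq_shell hR)) x

end Weyl

/-! ### Uniqueness of entire outgoing solutions -/

section Rellich

variable {k : ℝ} {h : R3 → ℂ}

/-- A bump in the variable `q = |x|²` that is one for `a ≤ |x| ≤ b` and supported in
`a - 1 ≤ |x| ≤ b + 1`. -/
lemma exists_annular_bump {a b : ℝ} (ha : 1 ≤ a) (hab : a < b) :
    ∃ β : ℝ → ℝ, ContDiff ℝ ∞ β ∧ (∀ q, 0 ≤ β q) ∧ (∀ q, β q ≤ 1) ∧
      (∀ q, a ^ 2 ≤ q → q ≤ b ^ 2 → β q = 1) ∧ (∀ q, q ≤ (a - 1) ^ 2 → β q = 0) ∧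
      ∀ q, (b + 1) ^ 2 ≤ q → β q = 0 := by
  have h1 : a ^ 2 < b ^ 2 := by gcongr
  -- The collar of width `a` fits on both sides because `(a - 1)² ≤ a² - a` and `b² + a ≤ (b + 1)²`.
  let f : ContDiffBump ((a ^ 2 + b ^ 2) / 2 : ℝ) :=
    ⟨(b ^ 2 - a ^ 2) / 2, (b ^ 2 - a ^ 2) / 2 + a, by linarith, by linarith⟩
  refine ⟨f, f.contDiff, fun q => f.nonneg, fun q => f.le_one, fun q h2 h3 => ?_, fun q hq => ?_,
    fun q hq => ?_⟩
  · refine f.one_of_mem_closedBall ?_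
    rw [mem_closedBall, Real.dist_eq, abs_le]
    constructor <;> simp only [f] <;> linarith
  · refine f.zero_of_le_dist ?_
    rw [Real.dist_eq, le_abs]
    right
    simp only [f]
    nlinarith
  · refine f.zero_of_le_dist ?_
    rw [Real.dist_eq, le_abs]
    left
    simp only [f]
    nlinarith

lemma hasFDerivAt_radial {θ β : ℝ → ℝ} (hθ : ∀ q, HasDerivAt θ (β q) q) (x : R3) :
    HasFDerivAt (fun x : R3 => θ (‖x‖ ^ 2)) (β (‖x‖ ^ 2) • (2 • innerSL ℝ x)) x :=
  (hθ _).comp_hasFDerivAt x (hasStrictFDerivAt_norm_sq x).hasFDerivAt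

lemma sum_coord_mul_apply (L : R3 →L[ℝ] ℂ) (x : R3) :
    ∑ i, (x i : ℂ) * L (basisVec i) = L x := by
  conv_rhs => rw [← (EuclideanSpace.basisFun (Fin 3) ℝ).sum_repr x, map_sum]
  refine Finset.sum_congr rfl fun i _ => ?_
  rw [map_smul, Complex.real_smul, EuclideanSpace.basisFun_repr]

/-- The flux of `Im (h̄ ∇h)` through spheres, averaged over radii, vanishes for solutions that are
defined on the whole space. -/
lemma IsWeakHelmholtz.integral_flux_eq_zero (hh : IsWeakHelmholtz k h) (hs : ContDiff ℝ ∞ h)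
    {β : ℝ → ℝ} (hβ : ContDiff ℝ ∞ β) {M : ℝ} (hM : 0 ≤ M) (hβM : ∀ q, M ^ 2 ≤ q → β q = 0) :
    ∫ x, β (‖x‖ ^ 2) * (conj (h x) * fderiv ℝ h x x).im = 0 := by
  -- With `θ' = β`, the function `θ(|x|²) h̄` is a test function whose gradient has the radial part
  -- `2 β(|x|²) h̄ x`; the rest of the tested equation is real.
  set θ : ℝ → ℝ := fun q => ∫ s in (M ^ 2)..q, β s
  have hθ' : ∀ q, HasDerivAt θ (β q) q := fun q =>
    intervalIntegral.integral_hasDerivAt_right (hβ.continuous.intervalIntegrable _ _)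
      hβ.continuous.aestronglyMeasurable.stronglyMeasurableAtFilter hβ.continuous.continuousAt
  have hθ : ContDiff ℝ ∞ θ := by
    refine contDiff_infty_iff_deriv.2 ⟨fun q => (hθ' q).differentiableAt, ?_⟩
    rwa [show deriv θ = β from funext fun q => (hθ' q).deriv]
  have hθM : ∀ q, M ^ 2 ≤ q → θ q = 0 := fun q hq => by
    have : ∫ s in (M ^ 2)..q, β s = ∫ s in (M ^ 2)..q, (0 : ℝ) := by
      refine intervalIntegral.integral_congr fun s hs' => ?_
      rw [Set.uIcc_of_le hq] at hs'
      exact hβM s hs'.1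
    simp only [θ, this, intervalIntegral.integral_zero]
  have hη : ContDiff ℝ ∞ (fun x : R3 => θ (‖x‖ ^ 2)) := hθ.comp (contDiff_norm_sq ℝ)
  have hconj : ContDiff ℝ ∞ (fun x => conj (h x)) := Complex.conjCLE.contDiff.comp hs
  have hφ : IsTest (fun x => (θ (‖x‖ ^ 2) : ℂ) * conj (h x)) := by
    refine isTest_of_zero_outside (ρ := M) ((Complex.ofRealCLM.contDiff.comp hη).mul hconj)
      fun x hx => ?_
    rw [hθM _ (by gcongr), Complex.ofReal_zero, zero_mul]
  have hd : ∀ x v, fderiv ℝ (fun x => (θ (‖x‖ ^ 2) : ℂ) * conj (h x)) x v =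
      (θ (‖x‖ ^ 2) : ℂ) * conj (fderiv ℝ h x v) +
        (2 * β (‖x‖ ^ 2) * inner ℝ x v : ℝ) * conj (h x) := fun x v => by
    have h1 : HasFDerivAt (fun x : R3 => (θ (‖x‖ ^ 2) : ℂ)) _ x :=
      Complex.ofRealCLM.hasFDerivAt.comp x (hasFDerivAt_radial hθ' x)
    have h2 : HasFDerivAt (fun x => conj (h x)) _ x :=
      Complex.conjCLE.hasFDerivAt.comp x (hs.differentiable (by simp) x).hasFDerivAt
    have h3 : HasFDerivAt (fun x => (θ (‖x‖ ^ 2) : ℂ) * conj (h x)) _ x := h1.mul h2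
    rw [h3.fderiv]
    simp
    ring
  have h0 := hh.eq_zero _ hφ
  simp_rw [mul_add] at h0
  have hi1 := integrable_mul_of_isTest hh.1 hφ.laplacian
  have hi2 : Integrable (fun x => h x * ((k : ℂ) ^ 2 * ((θ (‖x‖ ^ 2) : ℂ) * conj (h x)))) := by
    refine ((integrable_mul_of_isTest hh.1 hφ).const_mul ((k : ℂ) ^ 2)).congr
      (Eventually.of_forall fun x => ?_)
    simp only
    ring
  rw [integral_add hi1 hi2] at h0
  have hlap := integral_smul_laplacian_eq_sum hs hφ
  simp only [smul_eq_mul] at hlap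
  have him2 : (∫ x, h x * ((k : ℂ) ^ 2 * ((θ (‖x‖ ^ 2) : ℂ) * conj (h x)))).im = 0 := by
    rw [← Complex.imCLM_apply, ← Complex.imCLM.integral_comp_comm hi2]
    rw [← integral_zero R3 ℝ]
    congr 1
    funext x
    have : h x * ((k : ℂ) ^ 2 * ((θ (‖x‖ ^ 2) : ℂ) * conj (h x))) =
        ((k ^ 2 * θ (‖x‖ ^ 2) * Complex.normSq (h x) : ℝ) : ℂ) := by
      push_cast
      rw [← Complex.mul_conj]
      ring
    rw [this, Complex.imCLM_apply, Complex.ofReal_im]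
  have hisum : ∀ i : Fin 3, Integrable (fun x => fderiv ℝ h x (basisVec i) *
      fderiv ℝ (fun x => (θ (‖x‖ ^ 2) : ℂ) * conj (h x)) x (basisVec i)) := fun i =>
    integrable_mul_of_isTest (contDiff_dir hs _).continuous.locallyIntegrable (hφ.dir _)
  have hsum0 : ∑ i : Fin 3, ∫ x, (fderiv ℝ h x (basisVec i) *
      fderiv ℝ (fun x => (θ (‖x‖ ^ 2) : ℂ) * conj (h x)) x (basisVec i)).im = 0 := by
    have h1 := congrArg Complex.im h0
    rw [Complex.add_im, him2, add_zero, hlap, Complex.neg_im, Complex.im_sum, Complex.zero_im,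
      neg_eq_zero] at h1
    rw [← h1]
    refine Finset.sum_congr rfl fun i _ => ?_
    exact Complex.imCLM.integral_comp_comm (hisum i)
  have hisum' : ∀ i : Fin 3, Integrable (fun x => (fderiv ℝ h x (basisVec i) *
      fderiv ℝ (fun x => (θ (‖x‖ ^ 2) : ℂ) * conj (h x)) x (basisVec i)).im) := fun i =>
    Complex.imCLM.integrable_comp (hisum i)
  rw [← integral_finsetSum _ fun i _ => hisum' i] at hsum0
  have e : ∀ x, ∑ i : Fin 3, (fderiv ℝ h x (basisVec i) *
      fderiv ℝ (fun x => (θ (‖x‖ ^ 2) : ℂ) * conj (h x)) x (basisVec i)).im =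
      2 * (β (‖x‖ ^ 2) * (conj (h x) * fderiv ℝ h x x).im) := fun x => by
    rw [← sum_coord_mul_apply (fderiv ℝ h x) x, Finset.mul_sum, Complex.im_sum, Finset.mul_sum, Finset.mul_sum]
    refine Finset.sum_congr rfl fun i _ => ?_
    rw [hd, inner_basisVec]
    simp only [Complex.mul_im, Complex.mul_re, Complex.add_im, Complex.add_re, Complex.conj_re,
      Complex.conj_im, Complex.ofReal_re, Complex.ofReal_im]
    ring
  simp_rw [e] at hsum0
  rw [integral_const_mul] at hsum0
  linarith

/-- The radiation condition, combined with the vanishing of the flux, controls the mass of an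
entire solution in annuli. -/
lemma IsWeakHelmholtz.integral_annulus_le (hk : 0 < k) (hh : IsWeakHelmholtz k h)
    (hs : ContDiff ℝ ∞ h) {δ r₀ : ℝ} (hr₀ : 0 < r₀)
    (hout : ∀ x : R3, r₀ ≤ ‖x‖ →
      ‖(‖x‖ : ℂ) * (fderiv ℝ h x (‖x‖⁻¹ • x) - Complex.I * (k : ℂ) * h x)‖ < δ)
    {β : ℝ → ℝ} (hβ : ContDiff ℝ ∞ β) (hβ0 : ∀ q, 0 ≤ β q) {M : ℝ} (hM : 0 ≤ M)
    (hβM : ∀ q, M ^ 2 ≤ q → β q = 0) (hβr : ∀ q, q ≤ r₀ ^ 2 → β q = 0) :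
    k ^ 2 * r₀ ^ 2 * ∫ x, β (‖x‖ ^ 2) * ‖h x‖ ^ 2 ≤ δ ^ 2 * ∫ x : R3, β (‖x‖ ^ 2) := by
  have hflux := hh.integral_flux_eq_zero hs hβ hM hβM
  have hβn : Continuous fun x : R3 => β (‖x‖ ^ 2) := hβ.continuous.comp (by fun_prop)
  have hβc : HasCompactSupport fun x : R3 => β (‖x‖ ^ 2) := by
    refine HasCompactSupport.of_support_subset_isCompact (isCompact_closedBall 0 M) fun x hx => ?_
    by_contra hn
    rw [mem_closedBall_zero_iff, not_le] at hn
    exact hx (hβM _ (by gcongr))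
  have hint : ∀ {f : R3 → ℝ}, Continuous f → Integrable fun x => β (‖x‖ ^ 2) * f x := fun hf =>
    (hβn.mul hf).integrable_of_hasCompactSupport hβc.mul_right
  have hDc : Continuous fun x => (conj (h x) * fderiv ℝ h x x).im := by
    have h1 : Continuous (fderiv ℝ h) := hs.continuous_fderiv (by simp)
    have h2 := hs.continuous
    exact Complex.continuous_im.comp ((Complex.continuous_conj.comp h2).mul
      (h1.clm_apply continuous_id))
  have hpt : ∀ x, (k ^ 2 * r₀) * (β (‖x‖ ^ 2) * ‖h x‖ ^ 2) ≤
      (δ ^ 2 / r₀) * β (‖x‖ ^ 2) + (2 * k) * (β (‖x‖ ^ 2) * (conj (h x) * fderiv ℝ h x x).im) := by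
    intro x
    rcases le_or_gt ‖x‖ r₀ with hx | hx
    · rw [hβr _ (by gcongr)]
      simp
    · have hr : 0 < ‖x‖ := hr₀.trans hx
      set r := ‖x‖
      set D := fderiv ℝ h x x
      have h1 := hout x hx.le
      have e1 : (r : ℂ) * (fderiv ℝ h x (r⁻¹ • x) - Complex.I * (k : ℂ) * h x) =
          D - Complex.I * (k * r : ℝ) * h x := by
        rw [map_smul, Complex.real_smul]
        have : (r : ℂ) ≠ 0 := by exact_mod_cast hr.ne'
        push_cast
        simp only [D]
        field_simp
      rw [e1] at h1
      have h2 : ‖D - Complex.I * (k * r : ℝ) * h x‖ ^ 2 ≤ δ ^ 2 := by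
        gcongr
      -- The cross term of the square is, up to a factor, the flux density.
      have h3 : ‖D - Complex.I * (k * r : ℝ) * h x‖ ^ 2 = ‖D‖ ^ 2 + k ^ 2 * r ^ 2 * ‖h x‖ ^ 2 -
          2 * k * r * (conj (h x) * D).im := by
        simp only [← Complex.normSq_eq_norm_sq, Complex.normSq_apply, Complex.sub_re,
          Complex.sub_im, Complex.mul_re, Complex.mul_im, Complex.I_re, Complex.I_im,
          Complex.ofReal_re, Complex.ofReal_im, Complex.conj_re, Complex.conj_im]
        ring
      have h4 : k ^ 2 * r ^ 2 * ‖h x‖ ^ 2 ≤ δ ^ 2 + 2 * k * r * (conj (h x) * D).im := by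
        nlinarith [sq_nonneg ‖D‖]
      have h5 : k ^ 2 * r * ‖h x‖ ^ 2 ≤ δ ^ 2 / r + 2 * k * (conj (h x) * D).im := by
        have : k ^ 2 * r * ‖h x‖ ^ 2 = (k ^ 2 * r ^ 2 * ‖h x‖ ^ 2) / r := by field_simp
        rw [this, div_le_iff₀ hr]
        refine h4.trans (le_of_eq ?_)
        field_simp
      have h6 : δ ^ 2 / r ≤ δ ^ 2 / r₀ := by gcongr
      have h7 : k ^ 2 * r₀ * ‖h x‖ ^ 2 ≤ k ^ 2 * r * ‖h x‖ ^ 2 := by gcongr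
      have h8 := mul_le_mul_of_nonneg_left (h7.trans (h5.trans (add_le_add_left h6 _)))
        (hβ0 (r ^ 2))
      nlinarith [h8]
  have hI := integral_mono ((hint (by have := hs.continuous; fun_prop :
      Continuous fun x => ‖h x‖ ^ 2)).const_mul (k ^ 2 * r₀))
    (((hβn.integrable_of_hasCompactSupport hβc).const_mul (δ ^ 2 / r₀)).add
      ((hint hDc).const_mul (2 * k))) hpt
  simp only [Pi.add_apply] at hI
  rw [integral_add ((hβn.integrable_of_hasCompactSupport hβc).const_mul (δ ^ 2 / r₀))
      ((hint hDc).const_mul (2 * k)), integral_const_mul, integral_const_mul, integral_const_mul,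
      hflux, mul_zero, add_zero] at hI
  have := mul_le_mul_of_nonneg_left hI hr₀.le
  calc k ^ 2 * r₀ ^ 2 * ∫ x, β (‖x‖ ^ 2) * ‖h x‖ ^ 2 = _ := by ring
    _ ≤ _ := this
    _ = _ := by field_simp

/-- Annuli of fixed width `w` and inner radius `r₀` have volume `O(r₀²)`. -/
lemma integral_annulus_bump_le {β : ℝ → ℝ} (hβ0 : ∀ q, 0 ≤ β q) (hβ1 : ∀ q, β q ≤ 1) {r₀ w : ℝ}
    (hr₀ : 1 ≤ r₀) (hw : 0 ≤ w) (hβM : ∀ q, (r₀ + w) ^ 2 ≤ q → β q = 0)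
    (hβr : ∀ q, q ≤ r₀ ^ 2 → β q = 0) :
    ∫ x : R3, β (‖x‖ ^ 2) ≤ volume.real (ball (0 : R3) 1) * (3 * w + 3 * w ^ 2 + w ^ 3) * r₀ ^ 2 := by
  set A : Set R3 := closedBall 0 (r₀ + w) \ closedBall 0 r₀
  have hA : MeasurableSet A := measurableSet_closedBall.diff measurableSet_closedBall
  have hvol : volume.real A = ((r₀ + w) ^ 3 - r₀ ^ 3) * volume.real (ball (0 : R3) 1) := by
    rw [measureReal_sdiff (closedBall_subset_closedBall (by linarith)) measurableSet_closedBall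
      measure_closedBall_lt_top.ne, Measure.addHaar_real_closedBall _ _ (by linarith),
      Measure.addHaar_real_closedBall _ _ (by linarith)]
    simp only [finrank_euclideanSpace, Fintype.card_fin]
    ring
  have h1 : ∫ x : R3, β (‖x‖ ^ 2) ≤ ∫ x : R3, A.indicator (fun _ => (1 : ℝ)) x := by
    refine integral_mono_of_nonneg (Eventually.of_forall fun x => hβ0 _) ?_
      (Eventually.of_forall fun x => ?_)
    · refine (integrable_indicator_iff hA).2 (integrableOn_const ?_)
      exact ((measure_mono Set.sdiff_subset).trans_lt measure_closedBall_lt_top).ne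
    · by_cases hx : x ∈ A
      · rw [Set.indicator_of_mem hx]
        exact hβ1 _
      · rw [Set.indicator_of_notMem hx]
        refine le_of_eq ?_
        simp only [A, Set.mem_sdiff, mem_closedBall_zero_iff, not_and_or, not_le, not_lt] at hx
        rcases hx with hx | hx
        · exact hβM _ (by gcongr)
        · exact hβr _ (by gcongr)
  refine h1.trans ?_
  rw [integral_indicator_const _ hA, hvol, smul_eq_mul, mul_one]
  have hV : 0 ≤ volume.real (ball (0 : R3) 1) := measureReal_nonneg
  have h2 : (r₀ + w) ^ 3 - r₀ ^ 3 ≤ (3 * w + 3 * w ^ 2 + w ^ 3) * r₀ ^ 2 := by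
    have e1 : 0 ≤ w ^ 2 * (r₀ * (r₀ - 1)) := by
      have : 0 ≤ r₀ - 1 := by linarith
      positivity
    have e2 : 0 ≤ w ^ 3 * (r₀ ^ 2 - 1) := by
      have : 0 ≤ r₀ ^ 2 - 1 := by nlinarith
      positivity
    nlinarith
  calc _ ≤ (3 * w + 3 * w ^ 2 + w ^ 3) * r₀ ^ 2 * volume.real (ball (0 : R3) 1) := by gcongr
    _ = _ := by ring

/-- Uniqueness for the Helmholtz equation: an outgoing solution without sources vanishes. -/
theorem IsWeakHelmholtz.eq_zero_of_isOutgoing (hk : 0 < k) (hh : IsWeakHelmholtz k h)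
    (hs : ContDiff ℝ ∞ h) (hout : IsOutgoing k h) (x₀ : R3) : h x₀ = 0 := by
  obtain ⟨C, hC0, hC⟩ := exists_shellProfile_bound k
  set n := ‖x₀‖
  have hn : 0 ≤ n := norm_nonneg _
  set w := 2 * n + 3
  set V := volume.real (ball (0 : R3) 1) * (3 * w + 3 * w ^ 2 + w ^ 3)
  have hV : 0 ≤ V := by positivity
  have key : ∀ δ > 0, sphConst * ‖h x₀‖ ≤ C * V * (1 / k ^ 2 + 1) * δ := by
    intro δ hδ
    obtain ⟨R₀, hR₀, hR₀'⟩ := hout δ hδ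
    set r₀ := max R₀ 1
    have hr1 : 1 ≤ r₀ := le_max_right _ _
    have hr0 : 0 < r₀ := by linarith
    -- The shell `R ≤ |x₀ - y| ≤ R + 1` lies in the annulus `r₀ + 1 ≤ |y| ≤ R + 1 + n`.
    set R := r₀ + 1 + n
    have hR : 0 < R := by positivity
    obtain ⟨β, hβ, hβ0, hβ1, hβe, hβr, hβM⟩ :=
      exists_annular_bump (a := r₀ + 1) (b := R + 1 + n) (by linarith) (by simp only [R]; linarith)
    rw [show r₀ + 1 - 1 = r₀ by ring] at hβr
    rw [show R + 1 + n + 1 = r₀ + w by simp only [R, w]; ring] at hβM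
    have hann := hh.integral_annulus_le hk hs (δ := δ) hr0
      (fun x hx => (hR₀' x ((le_max_left _ _).trans hx)).2) hβ hβ0 (M := r₀ + w) (by positivity)
      hβM hβr
    have hvol := integral_annulus_bump_le hβ0 hβ1 hr1 (by positivity : 0 ≤ w) hβM hβr
    set I := ∫ x : R3, β (‖x‖ ^ 2)
    set J := ∫ x, β (‖x‖ ^ 2) * ‖h x‖ ^ 2
    have hβn : Continuous fun x : R3 => β (‖x‖ ^ 2) := hβ.continuous.comp (by fun_prop)
    have hβc : HasCompactSupport fun x : R3 => β (‖x‖ ^ 2) := by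
      refine HasCompactSupport.of_support_subset_isCompact (isCompact_closedBall 0 (r₀ + w))
        fun x hx => ?_
      by_contra hn
      rw [mem_closedBall_zero_iff, not_le] at hn
      exact hx (hβM _ (by gcongr))
    have hi1 : Integrable fun x : R3 => β (‖x‖ ^ 2) := hβn.integrable_of_hasCompactSupport hβc
    have hi2 : Integrable fun x : R3 => β (‖x‖ ^ 2) * ‖h x‖ ^ 2 :=
      (hβn.mul (hs.continuous.norm.pow 2)).integrable_of_hasCompactSupport hβc.mul_right
    have hpt : ∀ y, ‖kern (shellProfile k R) (x₀ - y) • h y‖ ≤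
        (C / R) * ((r₀ / δ) * (β (‖y‖ ^ 2) * ‖h y‖ ^ 2) + (δ / r₀) * β (‖y‖ ^ 2)) := by
      intro y
      have hrhs : 0 ≤ (C / R) * ((r₀ / δ) * (β (‖y‖ ^ 2) * ‖h y‖ ^ 2) +
          (δ / r₀) * β (‖y‖ ^ 2)) := by
        have := hβ0 (‖y‖ ^ 2)
        positivity
      rcases le_or_gt ‖x₀ - y‖ R with hy | hy
      · rw [kern, shellProfile_of_le hy, zero_div, zero_smul, norm_zero]
        exact hrhs
      rcases lt_or_ge (R + 1) ‖x₀ - y‖ with hy' | hy'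
      · rw [kern, shellProfile_of_lt hy', zero_div, zero_smul, norm_zero]
        exact hrhs
      have t1 : ‖x₀ - y‖ ≤ n + ‖y‖ := norm_sub_le _ _
      have t2 : ‖y‖ ≤ n + ‖x₀ - y‖ := by
        have := norm_sub_le x₀ (x₀ - y)
        rwa [sub_sub_cancel] at this
      have hb : β (‖y‖ ^ 2) = 1 := by
        have t3 : r₀ + 1 ≤ ‖y‖ := by simp only [R] at hy; linarith
        have t4 : ‖y‖ ≤ R + 1 + n := by linarith
        exact hβe _ (by gcongr) (by gcongr)
      rw [hb, one_mul, mul_one, norm_smul, kern, norm_div, norm_norm, Real.norm_eq_abs]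
      have h1 : |shellProfile k R ‖x₀ - y‖| / ‖x₀ - y‖ ≤ C / R := by
        gcongr
        exact hC _ _
      -- Young's inequality, with weights that balance the smallness `δ²` of the mass of `|h|²`
      -- against the volume `O(r₀²)` of the annulus.
      have h2 : ‖h y‖ ≤ (r₀ / δ) * ‖h y‖ ^ 2 + δ / r₀ := by
        have e : (r₀ / δ) * ‖h y‖ ^ 2 + δ / r₀ - ‖h y‖ =
            (r₀ / δ) * ((‖h y‖ - δ / (2 * r₀)) ^ 2 + 3 * (δ / (2 * r₀)) ^ 2) := by
          field_simp
          ring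
        have : 0 ≤ (r₀ / δ) * ((‖h y‖ - δ / (2 * r₀)) ^ 2 + 3 * (δ / (2 * r₀)) ^ 2) := by
          positivity
        linarith
      exact mul_le_mul h1 h2 (norm_nonneg _) (by positivity)
    have hshell := hh.eq_shell hs.continuous hR x₀
    have hle : ‖(sphConst : ℂ) * h x₀‖ ≤ (C / R) * ((r₀ / δ) * J + (δ / r₀) * I) := by
      rw [hshell, kernConv_eq_integral_sub]
      refine (norm_integral_le_of_norm_le (((hi2.const_mul _).add (hi1.const_mul _)).const_mul _)
        (Eventually.of_forall hpt)).trans (le_of_eq ?_)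
      rw [integral_const_mul]
      simp only [Pi.add_apply]
      rw [integral_add (hi2.const_mul _) (hi1.const_mul _), integral_const_mul, integral_const_mul]
    rw [norm_mul, Complex.norm_real, Real.norm_of_nonneg sphConst_pos.le] at hle
    refine hle.trans ?_
    have hJ : J ≤ δ ^ 2 * I / (k ^ 2 * r₀ ^ 2) := by
      rw [le_div_iff₀ (by positivity)]
      linarith
    have hrR : r₀ / R ≤ 1 := by
      rw [div_le_one hR]
      simp only [R]
      linarith
    calc (C / R) * ((r₀ / δ) * J + (δ / r₀) * I)
        ≤ (C / R) * ((r₀ / δ) * (δ ^ 2 * I / (k ^ 2 * r₀ ^ 2)) + (δ / r₀) * I) := by gcongr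
      _ = C * (1 / k ^ 2 + 1) * δ / (R * r₀) * I := by field_simp
      _ ≤ C * (1 / k ^ 2 + 1) * δ / (R * r₀) * (V * r₀ ^ 2) := by gcongr
      _ = C * V * (1 / k ^ 2 + 1) * δ * (r₀ / R) := by field_simp
      _ ≤ C * V * (1 / k ^ 2 + 1) * δ * 1 := by gcongr
      _ = _ := mul_one _
  have h0 : sphConst * ‖h x₀‖ ≤ 0 := by
    have hlim : Tendsto (fun δ : ℝ => C * V * (1 / k ^ 2 + 1) * δ) (𝓝[>] 0)
        (𝓝 (C * V * (1 / k ^ 2 + 1) * 0)) :=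
      ((continuous_const.mul continuous_id).tendsto 0).mono_left nhdsWithin_le_nhds
    rw [mul_zero] at hlim
    refine ge_of_tendsto hlim ?_
    filter_upwards [self_mem_nhdsWithin] with δ hδ using key δ hδ
  have h1 : ‖h x₀‖ ≤ 0 := nonpos_of_mul_nonpos_right h0 sphConst_pos
  exact norm_le_zero_iff.1 h1

end Rellich

/-! ### Essential supports -/

section Support

/-- A function vanishes almost everywhere off its essential support. -/
lemma ae_eq_zero_of_essSupport_subset {f : R3 → ℂ} {r : ℝ}
    (hf : essSupport f ⊆ closedBall 0 r) : ∀ᵐ x, r < ‖x‖ → f x = 0 := by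
  have h : volume {x : R3 | r < ‖x‖ ∧ f x ≠ 0} = 0 := by
    refine measure_null_of_locally_null _ fun x hx => ?_
    have hx' : x ∉ essSupport f := fun h => by
      have := hf h
      rw [mem_closedBall_zero_iff] at this
      exact absurd hx.1 (not_lt.2 this)
    simp only [essSupport, Set.mem_ofPred_eq, not_forall, not_not] at hx'
    obtain ⟨U, hU, hxU, hUz⟩ := hx'
    refine ⟨_, inter_mem_nhdsWithin _ (hU.mem_nhds hxU), ?_⟩
    refine measure_mono_null ?_ (ae_iff.1 hUz)
    rintro y ⟨hy, hyU⟩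
    simp only [Set.mem_ofPred_eq, Classical.not_imp]
    exact ⟨hyU, hy.2⟩
  rw [ae_iff]
  convert h using 2
  ext x
  simp

/-- A point is off the essential support once all pairings with test functions supported near it
vanish. -/
lemma notMem_essSupport (f : L2) {x : R3} {ρ : ℝ} (hρ : 0 < ρ)
    (h : ∀ φ, IsTest φ → (∀ y, ρ ≤ ‖y - x‖ → φ y = 0) → ∫ y, f y * φ y = 0) :
    x ∉ essSupport f := by
  intro hx
  refine hx (ball x ρ) isOpen_ball (mem_ball_self hρ) ?_
  refine isOpen_ball.ae_eq_zero_of_integral_contDiff_smul_eq_zero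
    (((Lp.memLp f).locallyIntegrable (by norm_num)).locallyIntegrableOn _) fun g hg hc hs => ?_
  have h0 := h _ (isTest_ofReal hg hc) fun y hy => by
    have hy' : y ∉ tsupport g := fun hm => by
      have := hs hm
      rw [mem_ball, dist_eq_norm] at this
      linarith
    rw [image_eq_zero_of_notMem_tsupport hy', Complex.ofReal_zero]
  rw [← h0]
  refine integral_congr_ae (Eventually.of_forall fun y => ?_)
  exact (Complex.real_smul).trans (mul_comm _ _)

end Support

/-! ### The active source and the time integral of the wave -/

section Source

variable {k T ε : ℝ} {F : L2} {u : ℝ → L2} {φ : R3 → ℂ}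

lemma pairing_smul_left (c : ℂ) (f g : L2) : pairing (c • f) g = c * pairing f g := by
  rw [pairing_apply, pairing_apply, ← integral_const_mul]
  refine integral_congr_ae ?_
  filter_upwards [Lp.coeFn_smul c f] with x hx
  rw [hx, Pi.smul_apply, smul_eq_mul, mul_assoc]

lemma integral_activeSource (hφ : IsTest φ) :
    ∫ x, activeSource k T u x * φ x = -(Complex.exp (-(Complex.I * k * T)) *
      ((∫ x, timeDeriv T u T x * φ x) + Complex.I * k * ∫ x, u T x * φ x)) := by
  simp_rw [← pairing_toL2 _ hφ, activeSource]
  rw [map_neg, neg_apply, pairing_smul_left, map_add, add_apply, pairing_smul_left]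

/-- The field `∫₀ᵀ e^{-ikt} u(t) dt`, whose source is `F + G`. -/
noncomputable def timeIntegral (k T : ℝ) (u : ℝ → L2) : L2 :=
  ∫ t in (0)..T, Complex.exp (-(Complex.I * k * t)) • u t

lemma integral_timeIntegral (hu : IsWaveSolution T F u) (hT : 0 < T) (hφ : IsTest φ) :
    ∫ x, timeIntegral k T u x * φ x =
      ∫ t in (0)..T, Complex.exp (-(Complex.I * k * t)) * ∫ x, u t x * φ x := by
  have hc : Continuous fun t : ℝ => Complex.exp (-(Complex.I * k * t)) := by fun_prop
  have hi : IntervalIntegrable (fun t : ℝ => Complex.exp (-(Complex.I * k * t)) • u t)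
      volume 0 T := (hc.continuousOn.smul hu.continuousOn).intervalIntegrable_of_Icc hT.le
  have h := (pairing.flip hφ.toL2).intervalIntegral_comp_comm hi
  simp only [ContinuousLinearMap.flip_apply, pairing_smul_left] at h
  simp_rw [← pairing_toL2 _ hφ]
  exact h.symm

lemma isTest_helmholtz (k : ℝ) (hφ : IsTest φ) :
    IsTest (fun x => Laplacian.laplacian φ x + (k : ℂ) ^ 2 * φ x) :=
  ⟨hφ.laplacian.1.add (contDiff_const.mul hφ.1), hφ.laplacian.2.add hφ.2.mul_left⟩

/-- Integrating the wave equation against `e^{-ikt}` gives `(Δ + k²) ∫₀ᵀ e^{-ikt} u dt = -F - G`;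
the boundary terms in time are the initial velocity and the active source. -/
lemma timeIntegral_helmholtz (hu : IsWaveSolution T F u) (hT : 0 < T) (hφ : IsTest φ) :
    ∫ x, timeIntegral k T u x * (Laplacian.laplacian φ x + (k : ℂ) ^ 2 * φ x) =
      -(∫ x, activeSource k T u x * φ x) - ∫ x, F x * φ x := by
  rw [integral_timeIntegral hu hT (isTest_helmholtz k hφ), integral_activeSource hφ]
  have hsplit : ∀ t, ∫ x, u t x * (Laplacian.laplacian φ x + (k : ℂ) ^ 2 * φ x) =
      (∫ x, u t x * Laplacian.laplacian φ x) + (k : ℂ) ^ 2 * ∫ x, u t x * φ x := fun t => by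
    rw [← integral_const_mul, ← integral_add (integrable_mul_test _ hφ.laplacian)
      ((integrable_mul_test _ hφ).const_mul _)]
    congr 1
    funext x
    ring
  simp_rw [hsplit]
  have hce : Continuous fun t : ℝ => Complex.exp (-(Complex.I * k * t)) := by fun_prop
  have hc0 := hu.continuousOn_integral hφ
  have hc1 : ContinuousOn (fun t => ∫ x, timeDeriv T u t x * φ x) (Set.Icc 0 T) := by
    simp_rw [← pairing_toL2 _ hφ]
    exact (pairing.flip hφ.toL2).continuous.comp_continuousOn (hu.continuousOn_timeDeriv hT)
  have hde : ∀ t : ℝ, HasDerivAt (fun t : ℝ => Complex.exp (-(Complex.I * k * t)))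
      (Complex.exp (-(Complex.I * k * t)) * -(Complex.I * k)) t := fun t => by
    have h1 : HasDerivAt (fun t : ℝ => -(Complex.I * k * (t : ℂ))) (-(Complex.I * k)) t :=
      ((Complex.ofRealCLM.hasDerivAt (x := t)).const_mul (Complex.I * (k : ℂ))).neg.congr_deriv
        (by simp)
    exact h1.cexp
  have hderiv : ∀ t ∈ Set.Ioo 0 T, HasDerivAt
      (fun t : ℝ => Complex.exp (-(Complex.I * k * t)) *
        ((∫ x, timeDeriv T u t x * φ x) + Complex.I * k * ∫ x, u t x * φ x))
      (Complex.exp (-(Complex.I * k * t)) *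
        ((∫ x, u t x * Laplacian.laplacian φ x) + (k : ℂ) ^ 2 * ∫ x, u t x * φ x)) t := by
    intro t ht
    refine ((hde t).mul ((hu.wave_equation φ hφ t ht).add
      ((hu.hasDerivAt_integral hφ ht).const_mul (Complex.I * (k : ℂ))))).congr_deriv ?_
    simp only [Pi.add_apply]
    linear_combination -(Complex.exp (-(Complex.I * k * t)) * (k : ℂ) ^ 2 *
      ∫ x, u t x * φ x) * Complex.I_sq
  have h := intervalIntegral.integral_eq_sub_of_hasDerivAt_of_le hT.le
    (hce.continuousOn.mul (hc1.add (continuousOn_const.mul hc0))) hderiv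
    ((hce.continuousOn.mul ((hu.continuousOn_integral hφ.laplacian).add
      (continuousOn_const.mul hc0))).intervalIntegrable_of_Icc hT.le)
  rw [h]
  simp only [Pi.add_apply, Pi.mul_apply]
  rw [hu.initial_velocity, hu.initial_value]
  have h0 : ∫ x, (0 : L2) x * φ x = 0 := by
    rw [← pairing_toL2 _ hφ, map_zero, zero_apply]
  rw [h0]
  simp

lemma timeIntegral_ae_eq_zero (hu : IsWaveSolution T F u) (hT : 0 < T)
    (hF : ∀ᵐ x, ε < ‖x‖ → F x = 0) :
    ∀ᵐ x, T + ε < ‖x‖ → timeIntegral k T u x = 0 := by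
  refine ae_eq_zero_of_essSupport_subset fun x hx => ?_
  by_contra hn
  rw [mem_closedBall_zero_iff, not_le] at hn
  refine notMem_essSupport _ (ρ := (‖x‖ - (T + ε)) / 2) (by linarith) (fun φ hφ hρ => ?_) hx
  rw [integral_timeIntegral hu hT hφ]
  have : ∀ t ∈ Set.uIcc 0 T,
      Complex.exp (-(Complex.I * k * t)) * ∫ x, u t x * φ x = 0 := fun t ht => by
    rw [Set.uIcc_of_le hT.le] at ht
    rw [hu.integral_eq_zero hT hF hφ hρ ht, mul_zero]
    rw [lt_abs]
    right
    linarith [ht.2]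
  rw [intervalIntegral.integral_congr (g := fun _ => 0) this, intervalIntegral.integral_zero]

/-- The active source lives where the wave can be at time `T`. -/
lemma essSupport_activeSource (hu : IsWaveSolution T F u) (hT : 0 < T)
    (hF : ∀ᵐ x, ε < ‖x‖ → F x = 0) {x : R3} (hx : x ∈ essSupport (activeSource k T u)) :
    |T - ‖x‖| ≤ ε := by
  by_contra hn
  rw [not_le] at hn
  refine notMem_essSupport _ (ρ := (|T - ‖x‖| - ε) / 2) (by linarith) (fun φ hφ hρ => ?_) hx
  rw [integral_activeSource hφ, hu.integral_timeDeriv_eq_zero hT hF hφ hρ (by linarith),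
    hu.integral_eq_zero hT hF hφ hρ ⟨hT.le, le_rfl⟩ (by linarith)]
  simp

end Source

/-! ### Cancellation outside the ball -/

section Outgoing

variable {k T ε : ℝ} {F : L2} {u : ℝ → L2}

/-- The radiation condition is additive and only concerns the behaviour at infinity. -/
lemma IsOutgoing.add_congr {w w' H : R3 → ℂ} (hw : IsOutgoing k w) (hw' : IsOutgoing k w')
    {r : ℝ} (hH : ∀ x, r < ‖x‖ → H x = w x + w' x) : IsOutgoing k H := by
  intro δ hδ
  obtain ⟨R, hR, h⟩ := hw (δ / 2) (half_pos hδ)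
  obtain ⟨R', -, h'⟩ := hw' (δ / 2) (half_pos hδ)
  refine ⟨max (max R R') (r + 1), lt_max_of_lt_left (lt_max_of_lt_left hR), fun x hx => ?_⟩
  obtain ⟨hd, hn⟩ := h x ((le_max_left _ _).trans ((le_max_left _ _).trans hx))
  obtain ⟨hd', hn'⟩ := h' x ((le_max_right _ _).trans ((le_max_left _ _).trans hx))
  have hr : r < ‖x‖ := by
    have := (le_max_right _ _).trans hx
    linarith
  have he : H =ᶠ[𝓝 x] fun x => w x + w' x := by
    filter_upwards [(isOpen_lt continuous_const continuous_norm).mem_nhds hr] with y hy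
    exact hH y hy
  refine ⟨(hd.add hd').congr_of_eventuallyEq he, ?_⟩
  rw [he.fderiv_eq, fderiv_fun_add hd hd', hH x hr, add_apply]
  rw [show (‖x‖ : ℂ) * (fderiv ℝ w x (‖x‖⁻¹ • x) + fderiv ℝ w' x (‖x‖⁻¹ • x) -
      Complex.I * k * (w x + w' x)) =
    (‖x‖ : ℂ) * (fderiv ℝ w x (‖x‖⁻¹ • x) - Complex.I * k * w x) +
      (‖x‖ : ℂ) * (fderiv ℝ w' x (‖x‖⁻¹ • x) - Complex.I * k * w' x) by ring]
  linarith [norm_add_le ((‖x‖ : ℂ) * (fderiv ℝ w x (‖x‖⁻¹ • x) - Complex.I * k * w x))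
    ((‖x‖ : ℂ) * (fderiv ℝ w' x (‖x‖⁻¹ • x) - Complex.I * k * w' x))]

/-- The sum of the two outgoing fields and the time integral of the wave differ by an entire
outgoing solution of the Helmholtz equation, hence not at all. -/
theorem add_eq_zero_of_lt_norm (hk : 0 < k) (hT : 0 < T) (hu : IsWaveSolution T F u)
    (hF : ∀ᵐ x, ε < ‖x‖ → F x = 0) {w w' : R3 → ℂ} (hw : IsOutgoingField k F w)
    (hw' : IsOutgoingField k (activeSource k T u) w') {x : R3} (hx : T + ε < ‖x‖) :
    w x + w' x = 0 := by
  have hV : LocallyIntegrable (timeIntegral k T u : R3 → ℂ) :=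
    (Lp.memLp _).locallyIntegrable (by norm_num)
  have hwl := hw.continuous.locallyIntegrable (μ := (volume : Measure R3))
  have hwl' := hw'.continuous.locallyIntegrable (μ := (volume : Measure R3))
  have hweak : IsWeakHelmholtz k (fun x => w x + w' x - timeIntegral k T u x) := by
    refine ⟨(hwl.add hwl').sub hV, fun φ hφ => ?_⟩
    have hψ := isTest_helmholtz k hφ
    have h1 := hw.helmholtz φ hφ
    have h2 := hw'.helmholtz φ hφ
    have h3 := timeIntegral_helmholtz (k := k) hu hT hφ
    simp_rw [sub_mul, add_mul]
    have hadd : Integrable (fun x => w x * (Laplacian.laplacian φ x + (k : ℂ) ^ 2 * φ x) +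
        w' x * (Laplacian.laplacian φ x + (k : ℂ) ^ 2 * φ x)) :=
      (integrable_mul_of_isTest hwl hψ).add (integrable_mul_of_isTest hwl' hψ)
    rw [integral_sub hadd
      (integrable_mul_of_isTest hV hψ), integral_add (integrable_mul_of_isTest hwl hψ)
      (integrable_mul_of_isTest hwl' hψ), h3]
    linear_combination h1 + h2
  obtain ⟨H, hHs, hHae, hHw⟩ := hweak.exists_contDiff
  have hUo : IsOpen {x : R3 | T + ε < ‖x‖} := isOpen_lt continuous_const continuous_norm
  have hHU : Set.EqOn H (fun x => w x + w' x) {x : R3 | T + ε < ‖x‖} := by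
    refine Measure.eqOn_open_of_ae_eq (μ := volume) ?_ hUo hHs.continuous.continuousOn
      (hw.continuous.add hw'.continuous).continuousOn
    rw [EventuallyEq, ae_restrict_iff' hUo.measurableSet]
    filter_upwards [hHae, timeIntegral_ae_eq_zero (k := k) hu hT hF] with y hy hyV hyU
    rw [← hy, hyV hyU, sub_zero]
  have hout : IsOutgoing k H := hw.outgoing.add_congr hw'.outgoing hHU
  rw [← hHw.eq_zero_of_isOutgoing hk hHs hout x]
  exact (hHU hx).symm

end Outgoing

end Shielding

theorem theorem2p1 (k ε T : ℝ) (hk : 0 < k) (hε : 0 < ε) (hT : 2 * ε < T)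
    (F : Shielding.L2) (hF : Shielding.essSupport F ⊆ closedBall 0 ε)
    (u : ℝ → Shielding.L2) (hu : Shielding.IsWaveSolution T F u) :
    Shielding.essSupport (Shielding.activeSource k T u) ⊆
        closedBall 0 (T + ε) \ ball 0 (T - ε) ∧
      Disjoint (Shielding.essSupport (Shielding.activeSource k T u)) (closedBall 0 ε) ∧
      ∀ w w' : Shielding.R3 → ℂ,
        Shielding.IsOutgoingField k F w →
        Shielding.IsOutgoingField k (Shielding.activeSource k T u) w' →
        ∀ x : Shielding.R3, x ∉ ball 0 (T + ε) → w x + w' x = 0 := by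
  have hT0 : 0 < T := by linarith
  have hF0 := Shielding.ae_eq_zero_of_essSupport_subset hF
  have hG : ∀ x ∈ Shielding.essSupport (Shielding.activeSource k T u), |T - ‖x‖| ≤ ε :=
    fun x hx => Shielding.essSupport_activeSource hu hT0 hF0 hx
  refine ⟨fun x hx => ?_, Set.disjoint_left.2 fun x hx hx' => ?_, fun w w' hw hw' => ?_⟩
  · have h := abs_le.1 (hG x hx)
    rw [Set.mem_sdiff, mem_closedBall_zero_iff, mem_ball_zero_iff]
    exact ⟨by linarith, by linarith⟩
  · have h := abs_le.1 (hG x hx)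
    rw [mem_closedBall_zero_iff] at hx'
    linarith
  · have h : Set.EqOn (fun x => w x + w' x) (fun _ => 0) (closedBall (0 : Shielding.R3) (T + ε))ᶜ :=
      fun x hx => by
        rw [Set.mem_compl_iff, mem_closedBall_zero_iff, not_le] at hx
        exact Shielding.add_eq_zero_of_lt_norm hk hT0 hu hF0 hw hw' hx
    have h' := h.closure (hw.continuous.add hw'.continuous) continuous_const
    rw [closure_compl, interior_closedBall _ (by linarith)] at h'
    exact fun x hx => h' hx
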